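/- Let $k$ be an integer with $k\not\equiv 0 \pmod{12}$, and let $v=v_\eta^{2k}$ be the weight-$k$ multiplier system on $\mathrm{SL}(2,\mathbb Z)$ defined by the Dedekind eta function, i.e. $\eta(gz)^{2k}=v(g)(cz+d)^k\eta(z)^{2k}$ for $g=\begin{pmatrix}a&b\\c&d\end{pmatrix}\in \mathrm{SL}(2,\mathbb Z)$; put $\Gamma=\mathrm{PSL}(2,\mathbb Z)$, $\xi=v\begin{pmatrix}1&1\\0&1\end{pmatrix}=e^{\pi i k/6}$ and $\chi_k(d)=i^{k(d-1)}$. For $u\in\{v,\overline v\}$ and $R\in\mathbb R$ let $\mathcal M(\Gamma,u,k,R)$ be the space of $C^2$ functions $f:\mathbb H\to\mathbb C$ such that $e^{-ik\operatorname{Arg}(cz+d)}f(gz)=u(g)f(z)$ for all $g=\begin{pmatrix}a&b\\c&d\end{pmatrix}\in\mathrm{SL}(2,\mathbb Z)$ and $z\in\mathbb H$, where $\operatorname{Arg}\in(-\pi,\pi]$; such that $\left(y^2(\partial_x^2+\partial_y^2)-iky\,\partial_x+\tfrac14+R^2\right)f=0$; and such that $\int_{\Gamma\backslash\mathbb H}|f|^2\,\frac{dx\,dy}{y^2}<\infty$.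 Let $\mathcal M(\Gamma,u,k)$ be the linear span of these spaces over all $R\in\mathbb R$, with the Petersson inner product $$(f,g)=\int_{\Gamma\backslash\mathbb H} f(z)\overline{g(z)}\,\frac{dx\,dy}{y^2}.$$ For a positive integer $m$ put $$T_mf(z)=\frac1{\sqrt m}\sum_{ad=m,\ d>0}\chi_k(d)\sum_{b=0}^{d-1}\xi^{-bd}f\!\left(\frac{az+b}{d}\right),\qquad T_m^{\overline v}f(z)=\frac1{\sqrt m}\sum_{ad=m,\ d>0}\chi_k(d)\sum_{b=0}^{d-1}\xi^{bd}f\!\left(\frac{az+b}{d}\right).$$ (1) If $n$ is a positive integer with $kn\equiv k\pmod{12}$, then $T_n$ maps $\mathcal M(\Gamma,v,k,R)$ to itself for every $R$, and $T_n^*=T_n$. (2) If $m$ is a positive integer with $km\equiv -k\pmod{12}$, then for every $R$ the operator $T_m$ maps $\mathcal M(\Gamma,v,k,R)$ to $\mathcal M(\Gamma,\overline v,k,R)$, the operator $T_m^{\overline v}$ maps $\mathcal M(\Gamma,\overline v,k,R)$ to $\mathcal M(\Gamma,v,k,R)$, and $$T_m^*=(-1)^k\,T_m^{\overline v},\qquad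 (T_m^{\overline v})^*=(-1)^k\,T_m .$$ Here $*$ denotes the (unique) adjoint with respect to the Petersson inner product. The statements hold both for the operators on the spaces with fixed $R$ and for the operators on $\mathcal M(\Gamma,v,k)$ and $\mathcal M(\Gamma,\overline v,k)$. -/

import Mathlib

open scoped MatrixGroups ComplexConjugate

noncomputable section

namespace EtaMaass

open UpperHalfPlane MeasureTheory

/-- The factor `j_g(z;k) = exp(i k Arg(cz+d))`, with the principal argument in `(-π, π]`. -/
def autoFactor (k : ℤ) (g : SL(2, ℤ)) (z : ℍ) : ℂ :=
  Complex.exp (Complex.I * k * Complex.arg (denom g z))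

/-- The weight `k` action `f|[k,g](z) = j_g(z;k)⁻¹ f(gz)`. -/
def slash (k : ℤ) (g : SL(2, ℤ)) (f : ℍ → ℂ) (z : ℍ) : ℂ :=
  (autoFactor k g z)⁻¹ * f (g • z)

/-- The eta multiplier `v_η(g) = η(gz) / ((cz+d)^{1/2} η(z))` (principal branch of the root).
The quotient is independent of the point `z` of the upper half-plane; it is evaluated at `z = i`. -/
def etaMultiplier (g : SL(2, ℤ)) : ℂ :=
  ModularForm.eta ((g • UpperHalfPlane.I : ℍ) : ℂ) /
    ((denom g UpperHalfPlane.I) ^ (1 / 2 : ℂ) * ModularForm.eta ((UpperHalfPlane.I : ℍ) : ℂ))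

/-- The multiplier system `v = v_η^{2k}` of weight `k`. -/
def multiplier (k : ℤ) (g : SL(2, ℤ)) : ℂ := etaMultiplier g ^ (2 * k)

/-- The conjugate multiplier system. -/
def conjMultiplier (v : SL(2, ℤ) → ℂ) (g : SL(2, ℤ)) : ℂ := conj (v g)

/-- The weight `k` Laplacian `Δ_k = y² (∂²/∂x² + ∂²/∂y²) - i k y ∂/∂x`. -/
def weightLaplacian (k : ℤ) (f : ℍ → ℂ) (z : ℍ) : ℂ :=
  (z.im : ℂ) ^ 2 * Laplacian.laplacian (f ∘ ofComplex) (z : ℂ)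
    - Complex.I * k * z.im * fderiv ℝ (f ∘ ofComplex) (z : ℂ) 1

/-- `f` is a Maass waveform of weight `k`, multiplier `v` and spectral parameter `R`. The measure
on `ℍ` is the hyperbolic one, `dx dy / y²`, and `ModularGroup.fd` is the standard fundamental
domain of the modular group. -/
structure IsMaassWaveform (v : SL(2, ℤ) → ℂ) (k : ℤ) (R : ℝ) (f : ℍ → ℂ) : Prop where
  contDiff : ∀ z : ℍ, ContDiffAt ℝ 2 (f ∘ ofComplex) (z : ℂ)
  slash_eq : ∀ (g : SL(2, ℤ)) (z : ℍ), slash k g f z = v g * f z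
  eigen : ∀ z : ℍ, weightLaplacian k f z + ((1 / 4 + R ^ 2 : ℝ) : ℂ) * f z = 0
  memLp : MemLp f 2 (volume.restrict ModularGroup.fd)

/-- The space of Maass waveforms with parameters `v`, `k`, `R`. -/
def maassSpace (v : SL(2, ℤ) → ℂ) (k : ℤ) (R : ℝ) : Submodule ℂ (ℍ → ℂ) where
  carrier := {f | IsMaassWaveform v k R f}
  zero_mem' := by
    have h0 : ((0 : ℍ → ℂ) ∘ ofComplex) = fun _ => (0 : ℂ) := rfl
    refine ⟨fun z => ?_, fun g z => ?_, fun z => ?_, MemLp.zero⟩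
    · rw [h0]; exact contDiffAt_const
    · simp [slash]
    · simp [weightLaplacian, h0]
  add_mem' := by
    rintro f g ⟨hf1, hf2, hf3, hf4⟩ ⟨hg1, hg2, hg3, hg4⟩
    have h0 : (f + g) ∘ ofComplex = f ∘ ofComplex + g ∘ ofComplex := rfl
    refine ⟨fun z => ?_, fun γ z => ?_, fun z => ?_, hf4.add hg4⟩
    · rw [h0]; exact (hf1 z).add (hg1 z)
    · have h1 := hf2 γ z
      have h2 := hg2 γ z
      simp only [slash, Pi.add_apply, mul_add] at *
      rw [h1, h2]
    · have h1 := hf3 z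
      have h2 := hg3 z
      have h3 := (hf1 z).laplacian_add (hg1 z)
      have h4 := fderiv_add ((hf1 z).differentiableAt (by norm_num))
        ((hg1 z).differentiableAt (by norm_num))
      simp only [weightLaplacian, h0, h3, h4, Pi.add_apply, add_apply] at *
      linear_combination h1 + h2
  smul_mem' := by
    rintro c f ⟨hf1, hf2, hf3, hf4⟩
    have h0 : (c • f) ∘ ofComplex = c • (f ∘ ofComplex) := rfl
    refine ⟨fun z => ?_, fun γ z => ?_, fun z => ?_, hf4.const_smul c⟩
    · rw [h0]; exact contDiffAt_const.smul (hf1 z)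
    · have h1 := hf2 γ z
      simp only [slash, Pi.smul_apply, smul_eq_mul] at *
      linear_combination c * h1
    · have h1 := hf3 z
      have h3 := InnerProductSpace.laplacian_smul c (hf1 z)
      have h4 := fderiv_const_smul ((hf1 z).differentiableAt (by norm_num)) c
      simp only [weightLaplacian, h0, h3, h4, Pi.smul_apply, smul_eq_mul,
        smul_apply] at *
      linear_combination c * h1

/-- The space spanned by the Maass waveforms with parameters `v`, `k` and any real `R`. -/
def maassSpaceAll (v : SL(2, ℤ) → ℂ) (k : ℤ) : Submodule ℂ (ℍ → ℂ) :=
  ⨆ R : ℝ, maassSpace v k R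

/-- `χ_k(d) = i^{k(d-1)}`. -/
def chi (k : ℤ) (d : ℕ) : ℂ := Complex.I ^ (k * ((d : ℤ) - 1))

/-- The Hecke operator `T_m^v`, with `ξ = v(T)`, `T = (1 1; 0 1)`:
`T_m^v f(z) = m^{-1/2} ∑_{ad=m, d>0} χ_k(d) ∑_{b mod d} ξ^{-bd} f((az+b)/d)`. -/
def hecke (v : SL(2, ℤ) → ℂ) (k : ℤ) (m : ℕ) : (ℍ → ℂ) →ₗ[ℂ] (ℍ → ℂ) where
  toFun f z := (1 / (Real.sqrt m : ℂ)) * ∑ p ∈ m.divisorsAntidiagonal,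
    chi k p.2 * ∑ b ∈ Finset.range p.2,
      v ModularGroup.T ^ (-((b : ℤ) * p.2)) * f (ofComplex ((p.1 * (z : ℂ) + b) / p.2))
  map_add' f g := by
    funext z
    simp only [Pi.add_apply, mul_add, Finset.sum_add_distrib]
  map_smul' c f := by
    funext z
    simp only [Pi.smul_apply, smul_eq_mul, RingHom.id_apply, Finset.mul_sum]
    refine Finset.sum_congr rfl fun p _ => Finset.sum_congr rfl fun b _ => ?_
    ring

/-- The Petersson inner product `∫_{Γ∖ℍ} f(z) conj(g(z)) dx dy / y²`. -/
def petersson (f g : ℍ → ℂ) : ℂ :=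
  ∫ z in ModularGroup.fd, f z * conj (g z)

/-- `T` restricts to an operator `V → W`, `S` restricts to an operator `W → V`, and the latter is
the (unique) adjoint of the former for the Petersson inner product. -/
def PeterssonAdjointEq (V W : Submodule ℂ (ℍ → ℂ)) (T S : (ℍ → ℂ) →ₗ[ℂ] (ℍ → ℂ)) : Prop :=
  ∃ (hT : ∀ f ∈ V, T f ∈ W) (hS : ∀ g ∈ W, S g ∈ V), ∀ B : W →ₗ[ℂ] V,
    (∀ (f : V) (g : W), petersson (T.restrict hT f : W) g = petersson f (B g : V)) ↔
      B = S.restrict hS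

end EtaMaass

end

open scoped MatrixGroups ComplexConjugate

noncomputable section

namespace EtaMaass

open UpperHalfPlane MeasureTheory

/-! ### The eta multiplier is a character -/

/-! Since `η²` has integral weight 1, the square of the eta multiplier is an honest character of
SL(2,ℤ), with `S ↦ ζ⁻³` and `T ↦ ζ` for `ζ = exp(πi/6)`. The logarithm of this character modulo 12
is given by an integral polynomial, `charExp`, in the matrix entries. The polynomial makes sense for
matrices `A` of any determinant, and `k * charExp` is still equivariant on both sides modulo 12 as
soon as `k * det A ≡ k`. This is a finite check modulo 3 and modulo 4 (`charExp_relations`). If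
instead `k * m ≡ -k`, apply this to `A * diag(1,-1)`, of determinant `-m`; conjugation by
`diag(1,-1)` inverts `S` and `T`, so the right-hand character becomes the conjugate one.

Thus `v` extends to a weight `w` on integral matrices of determinant `m`, with `w(gA) = v(g)w(A)`
and `w(Ag) = w(A)v'(g)`. On a triangular matrix `w⁻¹` is exactly `χ_k(d) ξ^{-bd}`, so the Hecke
operator is the sum of `w(A)⁻¹ f|A` over SL(2,ℤ)-cosets. Left equivariance makes it independent of
representatives, and right equivariance gives the image the multiplier `v'`
(`IsHeckeWeight.slash_heckeSum`). The eigenvalue equation survives because triangular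
representatives act by real affine maps, which commute with `Δ_k`.

For adjoints, a sum over cosets of integrals over the fundamental domain `F` unfolds to half the sum
over all `A` of integrals over `F ∩ A⁻¹F`. The substitution `(A, z) ↦ (adj A, Az)` preserves the
latter, because `adj A` acts as `A⁻¹` (`sum_integral_fd_adj`). It turns the integrand of `(Tf, g)`
into that of `(f, Sg)` up to the constant relating `w(adj A)` to the inverse weight: 1 in the first
case, `(-1)^k = v(-1)` in the second. The same unfolding applied to `|f(Az)|²` gives square
integrability (`memLp_comp_toGL`). Uniqueness of the adjoint is positive definiteness of the
Petersson product on continuous automorphic functions. -/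

/-- The twelfth roots of unity `exp(π i n / 6)`. -/
def zeta (n : ℤ) : ℂ := Complex.exp (Real.pi * Complex.I * n / 6)

lemma zeta_add (m n : ℤ) : zeta (m + n) = zeta m * zeta n := by
  rw [zeta, zeta, zeta, ← Complex.exp_add]
  congr 1
  push_cast
  ring

@[simp] lemma zeta_zero : zeta 0 = 1 := by simp [zeta]

lemma zeta_neg (n : ℤ) : zeta (-n) = (zeta n)⁻¹ := by
  refine eq_inv_of_mul_eq_one_left ?_
  rw [← zeta_add]
  simp

lemma zeta_mul (m n : ℤ) : zeta (m * n) = zeta m ^ n := by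
  rw [zeta, zeta, ← Complex.exp_int_mul]
  congr 1
  push_cast
  ring

@[simp] lemma norm_zeta (n : ℤ) : ‖zeta n‖ = 1 := by
  have h : (Real.pi * Complex.I * n / 6 : ℂ) = ((Real.pi * n / 6 : ℝ) : ℂ) * Complex.I := by
    push_cast
    ring
  rw [zeta, h, Complex.norm_exp_ofReal_mul_I]

lemma conj_zeta (n : ℤ) : conj (zeta n) = zeta (-n) := by
  rw [zeta_neg, Complex.inv_def, Complex.normSq_eq_norm_sq, norm_zeta]
  simp

lemma zeta_twelve_mul (n : ℤ) : zeta (12 * n) = 1 := by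
  rw [zeta, Complex.exp_eq_one_iff]
  refine ⟨n, ?_⟩
  push_cast
  ring

lemma zeta_congr {m n : ℤ} (h : (12 : ℤ) ∣ m - n) : zeta m = zeta n := by
  obtain ⟨c, hc⟩ := h
  rw [show m = n + 12 * c by omega, zeta_add, zeta_twelve_mul, mul_one]

lemma zeta_three : zeta 3 = Complex.I := by
  rw [zeta, show (Real.pi * Complex.I * (3 : ℤ) / 6 : ℂ) = Real.pi / 2 * Complex.I by
    push_cast
    ring, Complex.exp_pi_div_two_mul_I]

lemma zeta_six : zeta 6 = -1 := by
  rw [show (6 : ℤ) = 3 + 3 by norm_num, zeta_add, zeta_three, Complex.I_mul_I]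

lemma chi_eq (k : ℤ) (d : ℕ) : chi k d = zeta (3 * (k * ((d : ℤ) - 1))) := by
  rw [chi, zeta_mul, zeta_three]

lemma neg_one_zpow_eq (k : ℤ) : (-1 : ℂ) ^ k = zeta (6 * k) := by
  rw [zeta_mul, zeta_six]

/-! ### Transformation law of η² -/

lemma denom_coe_mul (g h : SL(2, ℤ)) (z : ℍ) :
    denom (g * h : SL(2, ℤ)) z = denom g ((h • z : ℍ) : ℂ) * denom h z := by
  have := denom_cocycle_σ (g : GL (Fin 2) ℝ) (h : GL (Fin 2) ℝ) z
  simpa [σ] using this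

lemma denom_T (z : ℍ) : denom ModularGroup.T z = 1 := by
  rw [ModularGroup.denom_apply]
  simp [ModularGroup.T]

lemma eta_sq_S_smul (z : ℍ) : ModularForm.eta ((ModularGroup.S • z : ℍ) : ℂ) ^ 2 =
    Complex.I⁻¹ * denom ModularGroup.S z * ModularForm.eta (z : ℂ) ^ 2 := by
  have h := ModularForm.eta_comp_eq_csqrt_I_inv z.2
  have h1 (w : ℂ) : Complex.sqrt w ^ 2 = w := by simp [Complex.sqrt]
  simp only [Function.comp_apply, Pi.smul_apply, Pi.mul_apply, smul_eq_mul] at h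
  have h2 : ((ModularGroup.S • z : ℍ) : ℂ) = -1 / z := by
    rw [modular_S_smul]
    simp [neg_div, inv_neg]
  rw [h2, h, ModularGroup.denom_S, mul_pow, mul_pow, inv_pow, h1, h1]
  ring

lemma eta_sq_T_smul (z : ℍ) : ModularForm.eta ((ModularGroup.T • z : ℍ) : ℂ) ^ 2 =
    zeta 1 * ModularForm.eta (z : ℂ) ^ 2 := by
  have h2 (n : ℕ) : ModularForm.eta_q n ((((1 : ℝ) +ᵥ z : ℍ)) : ℂ) = ModularForm.eta_q n z := by
    simp [ModularForm.eta_q, Function.Periodic.qParam, mul_add, Complex.exp_add]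
  rw [modular_T_smul, ModularForm.eta, ModularForm.eta]
  simp only [h2, mul_pow]
  rw [← mul_assoc]
  congr 1
  simp only [Function.Periodic.qParam, zeta, ← Complex.exp_nat_mul, ← Complex.exp_add]
  congr 1
  simp
  ring

/-- By the cocycle relation for `denom`, the matrices admitting such a constant form a subgroup, so
the generators `S` and `T` suffice. -/
lemma exists_eta_sq_smul (g : SL(2, ℤ)) : ∃ c : ℂ, ‖c‖ = 1 ∧ ∀ z : ℍ,
    ModularForm.eta ((g • z : ℍ) : ℂ) ^ 2 = c * denom g z * ModularForm.eta (z : ℂ) ^ 2 := by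
  have hg : g ∈ Subgroup.closure {ModularGroup.S, ModularGroup.T} := by
    rw [SpecialLinearGroup.SL2Z_generators]
    trivial
  induction hg using Subgroup.closure_induction with
  | mem x hx =>
    rcases hx with rfl | rfl
    · exact ⟨Complex.I⁻¹, by simp, eta_sq_S_smul⟩
    · exact ⟨zeta 1, by simp, fun z => by rw [eta_sq_T_smul, denom_T, mul_one]⟩
  | one => exact ⟨1, by simp, by simp⟩
  | mul x y _ _ hx hy =>
    obtain ⟨c, hc, hx⟩ := hx
    obtain ⟨d, hd, hy⟩ := hy
    refine ⟨c * d, by simp [hc, hd], fun z => ?_⟩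
    rw [mul_smul, hx, hy, denom_coe_mul]
    ring
  | inv x _ hx =>
    obtain ⟨c, hc, hx⟩ := hx
    have hc0 : c ≠ 0 := by
      rintro rfl
      simp at hc
    refine ⟨c⁻¹, by simp [hc], fun z => ?_⟩
    have h := hx (x⁻¹ • z)
    rw [smul_inv_smul] at h
    have h1 := denom_coe_mul x x⁻¹ z
    rw [mul_inv_cancel] at h1
    have h2 : denom (1 : SL(2, ℤ)) z = 1 := by simp
    rw [h2] at h1
    rw [h]
    have := denom_ne_zero (x : GL (Fin 2) ℝ) (x⁻¹ • z)
    have h3 : denom (x⁻¹ : SL(2, ℤ)) z = (denom x ((x⁻¹ • z : ℍ) : ℂ))⁻¹ :=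
      eq_inv_of_mul_eq_one_right h1.symm
    rw [h3]
    field_simp

/-- Squaring removes the branch of the root in `etaMultiplier`, so its value at `i` determines the
constant valid at every point. -/
lemma etaMultiplier_sq_eq (g : SL(2, ℤ)) (c : ℂ)
    (hc : ∀ z : ℍ, ModularForm.eta ((g • z : ℍ) : ℂ) ^ 2 =
      c * denom g z * ModularForm.eta (z : ℂ) ^ 2) : etaMultiplier g ^ 2 = c := by
  have h0 := ModularForm.eta_ne_zero UpperHalfPlane.I.2
  have h1 := denom_ne_zero (g : GL (Fin 2) ℝ) UpperHalfPlane.I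
  have h2 : ((denom g UpperHalfPlane.I) ^ (1 / 2 : ℂ)) ^ 2 = denom g UpperHalfPlane.I := by
    simp
  rw [etaMultiplier, div_pow, hc, mul_pow, h2]
  field_simp

lemma multiplier_eq (k : ℤ) (g : SL(2, ℤ)) : multiplier k g = (etaMultiplier g ^ 2) ^ k := by
  rw [multiplier, zpow_mul]
  rfl

lemma norm_etaMultiplier_sq (g : SL(2, ℤ)) : ‖etaMultiplier g ^ 2‖ = 1 := by
  obtain ⟨c, h1, hc⟩ := exists_eta_sq_smul g
  rw [etaMultiplier_sq_eq g c hc, h1]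

lemma eta_sq_smul (g : SL(2, ℤ)) (z : ℍ) : ModularForm.eta ((g • z : ℍ) : ℂ) ^ 2 =
    etaMultiplier g ^ 2 * denom g z * ModularForm.eta (z : ℂ) ^ 2 := by
  obtain ⟨c, -, hc⟩ := exists_eta_sq_smul g
  rw [etaMultiplier_sq_eq g c hc, hc]

lemma norm_multiplier (k : ℤ) (g : SL(2, ℤ)) : ‖multiplier k g‖ = 1 := by
  rw [multiplier_eq, norm_zpow, norm_etaMultiplier_sq, one_zpow]

lemma multiplier_mul (k : ℤ) (g h : SL(2, ℤ)) :
    multiplier k (g * h) = multiplier k g * multiplier k h := by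
  rw [multiplier_eq, multiplier_eq, multiplier_eq, ← mul_zpow]
  congr 1
  refine etaMultiplier_sq_eq _ _ fun z => ?_
  rw [mul_smul, eta_sq_smul, eta_sq_smul, denom_coe_mul]
  ring

lemma multiplier_S (k : ℤ) : multiplier k ModularGroup.S = zeta (-3 * k) := by
  rw [multiplier_eq, zeta_mul, etaMultiplier_sq_eq _ _ eta_sq_S_smul, zeta_neg, zeta_three]

lemma multiplier_T (k : ℤ) : multiplier k ModularGroup.T = zeta k := by
  rw [multiplier_eq, etaMultiplier_sq_eq _ (zeta 1), ← zeta_mul, one_mul]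
  intro z
  rw [eta_sq_T_smul, denom_T, mul_one]

/-! ### Weights on integral matrices of fixed determinant -/

/-- The polynomial whose reduction modulo `12` is the character of `SL(2, ℤ)` that generates its
group of characters. -/
def charExp {R : Type*} [CommRing R] (a b c d : R) : R :=
  (1 - c ^ 2) * (b * d + 3 * (c - 1) * d + c + 3) + c * (a + d - 3)

/-- Splitting modulo 3 and 4 keeps the five-variable check below small enough for `decide`. -/
lemma twelve_dvd_iff (x : ℤ) : 12 ∣ x ↔ (x : ZMod 3) = 0 ∧ (x : ZMod 4) = 0 := by
  have h3 := ZMod.intCast_zmod_eq_zero_iff_dvd x 3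
  have h4 := ZMod.intCast_zmod_eq_zero_iff_dvd x 4
  rw [h3, h4]
  omega

/-- Integral matrices of determinant `m`. -/
abbrev DetMatrix (m : ℕ) : Type := FixedDetMatrix (Fin 2) ℤ (m : ℤ)

namespace DetMatrix

variable {m : ℕ}

/-- Right multiplication by an element of the modular group. -/
def mulRight (A : DetMatrix m) (g : SL(2, ℤ)) : DetMatrix m :=
  ⟨A.1 * g.1, by rw [Matrix.det_mul, A.2, g.2, mul_one]⟩

/-- The adjugate matrix. -/
def adj (A : DetMatrix m) : DetMatrix m :=
  ⟨A.1.adjugate, by rw [Matrix.det_adjugate, A.2]; simp⟩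

lemma adj_adj (A : DetMatrix m) : adj (adj A) = A := by
  apply FixedDetMatrices.ext'
  simp [adj, Matrix.adjugate_adjugate]

/-- The adjugate as a permutation. -/
def adjEquiv (m : ℕ) : DetMatrix m ≃ DetMatrix m := ⟨adj, adj, adj_adj, adj_adj⟩

lemma smul_mulRight (A : DetMatrix m) (g h : SL(2, ℤ)) :
    g • mulRight A h = mulRight (g • A) h :=
  FixedDetMatrices.ext' _ _ (by
    rw [FixedDetMatrices.smul_coe]
    simp only [mulRight, FixedDetMatrices.smul_coe, mul_assoc])

lemma mulRight_mul (A : DetMatrix m) (g h : SL(2, ℤ)) :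
    mulRight A (g * h) = mulRight (mulRight A g) h :=
  FixedDetMatrices.ext' _ _ (by simp [mulRight, mul_assoc])

lemma mulRight_one (A : DetMatrix m) : mulRight A 1 = A :=
  FixedDetMatrices.ext' _ _ (by simp [mulRight])

lemma det_eq (A : DetMatrix m) : A.1 0 0 * A.1 1 1 - A.1 0 1 * A.1 1 0 = m :=
  (Matrix.det_fin_two A.1).symm.trans A.2

end DetMatrix

open DetMatrix

/-- A weight `w` on the integral matrices of determinant `m` transforms under the modular group on
the left by `v` and on the right by `v'`. -/
structure IsHeckeWeight {m : ℕ} (v v' : SL(2, ℤ) → ℂ) (w : DetMatrix m → ℂ) : Prop where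
  norm_eq : ∀ A, ‖w A‖ = 1
  left : ∀ (g : SL(2, ℤ)) A, w (g • A) = v g * w A
  right : ∀ (g : SL(2, ℤ)) A, w (mulRight A g) = w A * v' g

lemma forall_of_S_T {P : SL(2, ℤ) → Prop} (one : P 1) (S : P ModularGroup.S) (T : P ModularGroup.T)
    (mul : ∀ g h, P g → P h → P (g * h)) (inv : ∀ g, P g → P g⁻¹) (g : SL(2, ℤ)) : P g := by
  have hg : g ∈ Subgroup.closure {ModularGroup.S, ModularGroup.T} := by
    rw [SpecialLinearGroup.SL2Z_generators]
    trivial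
  induction hg using Subgroup.closure_induction with
  | mem x hx =>
    rcases hx with rfl | rfl
    · exact S
    · exact T
  | one => exact one
  | mul x y _ _ hx hy => exact mul x y hx hy
  | inv x _ hx => exact inv x hx

/-- Each equivariance holds on a subgroup, because `v` and `v'` are characters; hence four
identities on generators are enough. -/
lemma IsHeckeWeight.of_S_T {m : ℕ} {v v' : SL(2, ℤ) → ℂ} {w : DetMatrix m → ℂ}
    (hv : ∀ g, ‖v g‖ = 1) (hv' : ∀ g, ‖v' g‖ = 1) (hvm : ∀ g h, v (g * h) = v g * v h)
    (hvm' : ∀ g h, v' (g * h) = v' g * v' h) (norm_eq : ∀ A, ‖w A‖ = 1)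
    (lS : ∀ A, w (ModularGroup.S • A) = v ModularGroup.S * w A)
    (lT : ∀ A, w (ModularGroup.T • A) = v ModularGroup.T * w A)
    (rS : ∀ A, w (mulRight A ModularGroup.S) = w A * v' ModularGroup.S)
    (rT : ∀ A, w (mulRight A ModularGroup.T) = w A * v' ModularGroup.T) :
    IsHeckeWeight v v' w := by
  have hone {u : SL(2, ℤ) → ℂ} (hu : ∀ g, ‖u g‖ = 1) (hum : ∀ g h, u (g * h) = u g * u h) :
      u 1 = 1 := by
    have h := hum 1 1
    have h0 : u 1 ≠ 0 := by
      intro h0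
      have := hu 1
      simp [h0] at this
    rw [mul_one] at h
    exact (mul_eq_left₀ h0).1 h.symm
  refine ⟨norm_eq, ?_, ?_⟩
  · refine forall_of_S_T (fun A => ?_) lS lT (fun g h hg hh A => ?_) (fun g hg A => ?_)
    · rw [one_smul, hone hv hvm, one_mul]
    · rw [mul_smul, hg, hh, hvm, mul_assoc]
    · have h := hg (g⁻¹ • A)
      rw [smul_inv_smul] at h
      rw [h, ← mul_assoc, ← hvm, inv_mul_cancel, hone hv hvm, one_mul]
  · refine forall_of_S_T (fun A => ?_) rS rT (fun g h hg hh A => ?_) (fun g hg A => ?_)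
    · rw [mulRight_one, hone hv' hvm', mul_one]
    · rw [mulRight_mul, hh, hg, hvm', mul_assoc]
    · have h := hg (mulRight A g⁻¹)
      rw [← mulRight_mul, inv_mul_cancel, mulRight_one] at h
      rw [h, mul_assoc, ← hvm', mul_inv_cancel, hone hv' hvm', mul_one]

@[norm_cast]
lemma charExp_intCast {R : Type*} [CommRing R] (a b c d : ℤ) :
    ((charExp a b c d : ℤ) : R) = charExp (a : R) (b : R) (c : R) (d : R) := by
  simp [charExp]

lemma charExp_relations_zmod_three : ∀ k a b c d : ZMod 3, k * (a * d - b * c) = k →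
    k * (charExp (-c) (-d) a b - charExp a b c d + 3) = 0 ∧
    k * (charExp (a + c) (b + d) c d - charExp a b c d - 1) = 0 ∧
    k * (charExp b (-a) d (-c) - charExp a b c d + 3) = 0 ∧
    k * (charExp a (a + b) c (c + d) - charExp a b c d - 1) = 0 ∧
    k * (charExp d (-b) (-c) a + charExp a b c d) = 0 ∧
    k * (charExp (-b) a (-d) c - charExp a b c d - 3) = 0 ∧
    k * (charExp a (b - a) c (d - c) - charExp a b c d + 1) = 0 ∧
    k * (charExp (-d) (-b) (-c) (-a) - charExp a b c d - 6) = 0 := by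
  decide +kernel

lemma charExp_relations_zmod_four : ∀ k a b c d : ZMod 4, k * (a * d - b * c) = k →
    k * (charExp (-c) (-d) a b - charExp a b c d + 3) = 0 ∧
    k * (charExp (a + c) (b + d) c d - charExp a b c d - 1) = 0 ∧
    k * (charExp b (-a) d (-c) - charExp a b c d + 3) = 0 ∧
    k * (charExp a (a + b) c (c + d) - charExp a b c d - 1) = 0 ∧
    k * (charExp d (-b) (-c) a + charExp a b c d) = 0 ∧
    k * (charExp (-b) a (-d) c - charExp a b c d - 3) = 0 ∧
    k * (charExp a (b - a) c (d - c) - charExp a b c d + 1) = 0 ∧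
    k * (charExp (-d) (-b) (-c) (-a) - charExp a b c d - 6) = 0 := by
  decide +kernel

/-- In order: left multiplication by `S`, `T`; right multiplication by `S`, `T`; the adjugate; right
multiplication by `S⁻¹`, `T⁻¹`; and `(a b; c d) ↦ -(d b; c a)`. On SL(2,ℤ) the map `(a b; c d) ↦ (d
b; c a)` is an anti-automorphism fixing `S` and `T`, hence preserves the character, and the 6 comes
from `-1 = S²`. -/
lemma charExp_relations {k a b c d : ℤ} (h : 12 ∣ k * (a * d - b * c) - k) :
    12 ∣ k * (charExp (-c) (-d) a b - charExp a b c d + 3) ∧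
    12 ∣ k * (charExp (a + c) (b + d) c d - charExp a b c d - 1) ∧
    12 ∣ k * (charExp b (-a) d (-c) - charExp a b c d + 3) ∧
    12 ∣ k * (charExp a (a + b) c (c + d) - charExp a b c d - 1) ∧
    12 ∣ k * (charExp d (-b) (-c) a + charExp a b c d) ∧
    12 ∣ k * (charExp (-b) a (-d) c - charExp a b c d - 3) ∧
    12 ∣ k * (charExp a (b - a) c (d - c) - charExp a b c d + 1) ∧
    12 ∣ k * (charExp (-d) (-b) (-c) (-a) - charExp a b c d - 6) := by
  rw [twelve_dvd_iff] at h
  push_cast [sub_eq_zero] at h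
  have h3 := charExp_relations_zmod_three _ _ _ _ _ h.1
  have h4 := charExp_relations_zmod_four _ _ _ _ _ h.2
  simp only [twelve_dvd_iff]
  push_cast
  exact ⟨⟨h3.1, h4.1⟩, ⟨h3.2.1, h4.2.1⟩, ⟨h3.2.2.1, h4.2.2.1⟩, ⟨h3.2.2.2.1, h4.2.2.2.1⟩,
    ⟨h3.2.2.2.2.1, h4.2.2.2.2.1⟩, ⟨h3.2.2.2.2.2.1, h4.2.2.2.2.2.1⟩, ⟨h3.2.2.2.2.2.2.1, h4.2.2.2.2.2.2.1⟩,
    ⟨h3.2.2.2.2.2.2.2, h4.2.2.2.2.2.2.2⟩⟩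

/-- The weight attached to `T_m` when `k m ≡ k` modulo `12`. -/
def weightPos (k : ℤ) {m : ℕ} (A : DetMatrix m) : ℂ :=
  zeta (k * charExp (A.1 0 0) (A.1 0 1) (A.1 1 0) (A.1 1 1))

/-- The weight attached to `T_m` when `k m ≡ -k` modulo `12`. -/
def weightNeg (k : ℤ) {m : ℕ} (A : DetMatrix m) : ℂ :=
  zeta (k * (charExp (A.1 0 0) (-A.1 0 1) (A.1 1 0) (-A.1 1 1) + 6))

lemma zeta_eq_of_dvd {x y z : ℤ} (h : 12 ∣ x - y - z) : zeta x = zeta z * zeta y := by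
  rw [← zeta_add]
  exact zeta_congr (by rwa [show x - (z + y) = x - y - z by ring])

lemma S_smul_entries {m : ℕ} (A : DetMatrix m) :
    (ModularGroup.S • A).1 0 0 = -A.1 1 0 ∧ (ModularGroup.S • A).1 0 1 = -A.1 1 1 ∧
      (ModularGroup.S • A).1 1 0 = A.1 0 0 ∧ (ModularGroup.S • A).1 1 1 = A.1 0 1 := by
  rw [FixedDetMatrices.smul_coe]
  simp [ModularGroup.S, Matrix.mul_apply, Fin.sum_univ_two]

lemma T_smul_entries {m : ℕ} (A : DetMatrix m) :
    (ModularGroup.T • A).1 0 0 = A.1 0 0 + A.1 1 0 ∧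
      (ModularGroup.T • A).1 0 1 = A.1 0 1 + A.1 1 1 ∧
      (ModularGroup.T • A).1 1 0 = A.1 1 0 ∧ (ModularGroup.T • A).1 1 1 = A.1 1 1 := by
  rw [FixedDetMatrices.smul_coe]
  simp [ModularGroup.T, Matrix.mul_apply, Fin.sum_univ_two]

lemma mulRight_S_entries {m : ℕ} (A : DetMatrix m) :
    (mulRight A ModularGroup.S).1 0 0 = A.1 0 1 ∧ (mulRight A ModularGroup.S).1 0 1 = -A.1 0 0 ∧
      (mulRight A ModularGroup.S).1 1 0 = A.1 1 1 ∧
      (mulRight A ModularGroup.S).1 1 1 = -A.1 1 0 := by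
  simp [mulRight, ModularGroup.S, Matrix.mul_apply, Fin.sum_univ_two]

lemma mulRight_T_entries {m : ℕ} (A : DetMatrix m) :
    (mulRight A ModularGroup.T).1 0 0 = A.1 0 0 ∧
      (mulRight A ModularGroup.T).1 0 1 = A.1 0 0 + A.1 0 1 ∧
      (mulRight A ModularGroup.T).1 1 0 = A.1 1 0 ∧
      (mulRight A ModularGroup.T).1 1 1 = A.1 1 0 + A.1 1 1 := by
  simp [mulRight, ModularGroup.T, Matrix.mul_apply, Fin.sum_univ_two]

lemma adj_entries {m : ℕ} (A : DetMatrix m) :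
    (adj A).1 0 0 = A.1 1 1 ∧ (adj A).1 0 1 = -A.1 0 1 ∧ (adj A).1 1 0 = -A.1 1 0 ∧
      (adj A).1 1 1 = A.1 0 0 := by
  simp [adj, Matrix.adjugate_fin_two]

lemma norm_conjMultiplier (k : ℤ) (g : SL(2, ℤ)) : ‖conjMultiplier (multiplier k) g‖ = 1 := by
  rw [conjMultiplier, RCLike.norm_conj, norm_multiplier]

lemma conjMultiplier_mul (k : ℤ) (g h : SL(2, ℤ)) : conjMultiplier (multiplier k) (g * h) =
    conjMultiplier (multiplier k) g * conjMultiplier (multiplier k) h := by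
  rw [conjMultiplier, multiplier_mul, map_mul]
  rfl

lemma isHeckeWeight_weightPos {k : ℤ} {m : ℕ} (h : k * m ≡ k [ZMOD 12]) :
    IsHeckeWeight (multiplier k) (multiplier k) (weightPos k (m := m)) := by
  have key (A : DetMatrix m) := charExp_relations (k := k) (a := A.1 0 0) (b := A.1 0 1)
    (c := A.1 1 0) (d := A.1 1 1) (by rw [det_eq]; exact h.symm.dvd)
  refine .of_S_T (norm_multiplier k) (norm_multiplier k) (multiplier_mul k) (multiplier_mul k)
    (fun A => norm_zeta _) (fun A => ?_) (fun A => ?_) (fun A => ?_) (fun A => ?_)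
  · obtain ⟨h1, h2, h3, h4⟩ := S_smul_entries A
    rw [weightPos, h1, h2, h3, h4, multiplier_S]
    exact zeta_eq_of_dvd (by convert (key A).1 using 1; ring)
  · obtain ⟨h1, h2, h3, h4⟩ := T_smul_entries A
    rw [weightPos, h1, h2, h3, h4, multiplier_T]
    exact zeta_eq_of_dvd (by convert (key A).2.1 using 1; ring)
  · obtain ⟨h1, h2, h3, h4⟩ := mulRight_S_entries A
    rw [weightPos, h1, h2, h3, h4, multiplier_S, mul_comm]
    exact zeta_eq_of_dvd (by convert (key A).2.2.1 using 1; ring)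
  · obtain ⟨h1, h2, h3, h4⟩ := mulRight_T_entries A
    rw [weightPos, h1, h2, h3, h4, multiplier_T, mul_comm]
    exact zeta_eq_of_dvd (by convert (key A).2.2.2.1 using 1; ring)

lemma weightPos_adj {k : ℤ} {m : ℕ} (h : k * m ≡ k [ZMOD 12]) (A : DetMatrix m) :
    weightPos k (adj A) = (weightPos k A)⁻¹ := by
  have key := charExp_relations (k := k) (a := A.1 0 0) (b := A.1 0 1)
    (c := A.1 1 0) (d := A.1 1 1) (by rw [det_eq]; exact h.symm.dvd)
  obtain ⟨h1, h2, h3, h4⟩ := adj_entries A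
  rw [weightPos, h1, h2, h3, h4, weightPos, ← zeta_neg]
  exact zeta_congr (by convert key.2.2.2.2.1 using 1; ring)

lemma isHeckeWeight_weightNeg {k : ℤ} {m : ℕ} (h : k * m ≡ -k [ZMOD 12]) :
    IsHeckeWeight (multiplier k) (conjMultiplier (multiplier k)) (weightNeg k (m := m)) := by
  have key (A : DetMatrix m) := charExp_relations (k := k) (a := A.1 0 0) (b := -A.1 0 1)
    -- These are the entries of `A * diag(1,-1)`, whose determinant `-m` satisfies `k * (-m) ≡ k`.
    (c := A.1 1 0) (d := -A.1 1 1) (by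
      have h1 := h.dvd
      rw [← det_eq A] at h1
      convert h1 using 1
      ring)
  refine .of_S_T (norm_multiplier k) (norm_conjMultiplier k) (multiplier_mul k)
    (conjMultiplier_mul k) (fun A => norm_zeta _) (fun A => ?_) (fun A => ?_) (fun A => ?_)
    (fun A => ?_)
  · obtain ⟨h1, h2, h3, h4⟩ := S_smul_entries A
    rw [weightNeg, h1, h2, h3, h4, multiplier_S]
    exact zeta_eq_of_dvd (by convert (key A).1 using 1; ring)
  · obtain ⟨h1, h2, h3, h4⟩ := T_smul_entries A
    rw [weightNeg, h1, h2, h3, h4, multiplier_T, neg_add]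
    exact zeta_eq_of_dvd (by convert (key A).2.1 using 1; simp [charExp]; ring)
  · obtain ⟨h1, h2, h3, h4⟩ := mulRight_S_entries A
    rw [weightNeg, h1, h2, h3, h4, conjMultiplier, multiplier_S, conj_zeta, mul_comm]
    exact zeta_eq_of_dvd (by convert (key A).2.2.2.2.2.1 using 1; simp [charExp]; ring)
  · obtain ⟨h1, h2, h3, h4⟩ := mulRight_T_entries A
    rw [weightNeg, h1, h2, h3, h4, conjMultiplier, multiplier_T, conj_zeta, mul_comm]
    exact zeta_eq_of_dvd (by convert (key A).2.2.2.2.2.2.1 using 1; simp [charExp]; ring)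

lemma weightNeg_adj {k : ℤ} {m : ℕ} (h : k * m ≡ -k [ZMOD 12]) (A : DetMatrix m) :
    weightNeg k (adj A) = (-1) ^ k * weightNeg k A := by
  have key := charExp_relations (k := k) (a := A.1 0 0) (b := -A.1 0 1)
    (c := A.1 1 0) (d := -A.1 1 1) (by
      have h1 := h.dvd
      rw [← det_eq A] at h1
      convert h1 using 1
      ring)
  obtain ⟨h1, h2, h3, h4⟩ := adj_entries A
  rw [weightNeg, h1, h2, h3, h4, weightNeg, neg_one_zpow_eq]
  exact zeta_eq_of_dvd (by convert key.2.2.2.2.2.2.2 using 1; simp [charExp]; ring)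

lemma IsHeckeWeight.conj {m : ℕ} {v v' : SL(2, ℤ) → ℂ} {w : DetMatrix m → ℂ}
    (hw : IsHeckeWeight v v' w) :
    IsHeckeWeight (conjMultiplier v) (conjMultiplier v') (fun A => conj (w A)) where
  norm_eq A := by rw [RCLike.norm_conj, hw.norm_eq]
  left g A := by rw [hw.left, map_mul, conjMultiplier]
  right g A := by rw [hw.right, map_mul, conjMultiplier]

open DetMatrix

/-! ### Representatives of integral matrices modulo the modular group -/

/-- The upper triangular representatives `(a b; 0 d)`, `a > 0`, `0 ≤ b < d`. -/
abbrev Rep (m : ℕ) : Type := FixedDetMatrices.reps (m : ℤ)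

namespace DetMatrix

variable {m : ℕ}

lemma rep_d_pos (r : Rep m) : 0 < r.1.1 1 1 := by
  obtain ⟨A, h10, h00, h01, h11⟩ := r
  have h := det_eq A
  rw [h10, mul_zero, sub_zero] at h
  have h1 : A.1 1 1 ≠ 0 := by
    intro h0
    rw [h0, abs_zero] at h11
    exact absurd h11 (abs_nonneg _).not_gt
  have h2 : 0 ≤ A.1 0 0 * A.1 1 1 := by rw [h]; positivity
  exact lt_of_le_of_ne (nonneg_of_mul_nonneg_right h2 h00) h1.symm

lemma exists_smul_rep [NeZero m] (A : DetMatrix m) : ∃ (r : Rep m) (g : SL(2, ℤ)), g • r.1 = A := by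
  refine FixedDetMatrices.induction_on (A := A)
    (C := fun A => ∃ (r : Rep m) (g : SL(2, ℤ)), g • r.1 = A) (by exact_mod_cast NeZero.ne m)
    (fun A h1 h2 h3 h4 => ⟨⟨A, h1, h2, h3, h4⟩, 1, one_smul _ _⟩) ?_ ?_
  · rintro B ⟨r, g, rfl⟩
    exact ⟨r, _, mul_smul _ _ _⟩
  · rintro B ⟨r, g, rfl⟩
    exact ⟨r, _, mul_smul _ _ _⟩

lemma rep_unique (r s : Rep m) (g : SL(2, ℤ)) (h : g • r.1 = s.1) : g = 1 ∧ r = s := by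
  have hdr := rep_d_pos r
  have hds := rep_d_pos s
  obtain ⟨A, a10, a00, a01, a11⟩ := r
  obtain ⟨B, b10, b00, b01, b11⟩ := s
  simp only at h hdr hds
  rw [abs_of_nonneg a01, abs_of_pos hdr] at a11
  rw [abs_of_nonneg b01, abs_of_pos hds] at b11
  have hB : B.1 = g.1 * A.1 := by rw [← h, FixedDetMatrices.smul_coe]
  have e (i j : Fin 2) : B.1 i j = g.1 i 0 * A.1 0 j + g.1 i 1 * A.1 1 j := by
    rw [hB, Matrix.mul_apply, Fin.sum_univ_two]
  have e10 := e 1 0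
  have e00 := e 0 0
  have e01 := e 0 1
  have e11 := e 1 1
  have hg := g.2
  rw [Matrix.det_fin_two] at hg
  rw [a10, b10, mul_zero, add_zero, eq_comm, mul_eq_zero] at e10
  have g10 : g.1 1 0 = 0 := e10.resolve_right a00.ne'
  rw [a10, mul_zero, add_zero] at e00
  rw [g10, zero_mul, zero_add] at e11
  rw [g10, mul_zero, sub_zero] at hg
  have g00 : 0 < g.1 0 0 := pos_of_mul_pos_left (by rw [← e00]; exact b00) a00.le
  have g00' : g.1 0 0 = 1 := by
    rcases Int.mul_eq_one_iff_eq_one_or_neg_one.1 hg with h | h <;> omega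
  have g11 : g.1 1 1 = 1 := by rw [g00', one_mul] at hg; exact hg
  rw [g00', one_mul] at e01
  rw [g11, one_mul] at e11
  -- The upper right entries both lie in `[0, d)` and differ by `g01 * d`.
  have g01 : g.1 0 1 = 0 := by
    rw [e11] at b11
    by_contra h0
    rcases lt_or_gt_of_ne h0 with h0 | h0
    · nlinarith
    · nlinarith
  have hg1 : g = 1 := by
    ext i j
    fin_cases i <;> fin_cases j <;> simp [g00', g01, g10, g11]
  refine ⟨hg1, ?_⟩
  rw [hg1, one_smul] at h
  exact Subtype.ext h

/-- Every matrix of determinant `m` is uniquely the product of an element of the modular group and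
a representative. -/
def repEquiv (m : ℕ) [NeZero m] : Rep m × SL(2, ℤ) ≃ DetMatrix m :=
  Equiv.ofBijective (fun p => p.2 • p.1.1) <| by
    refine ⟨fun ⟨r, g⟩ ⟨s, h⟩ hp => ?_, fun A => ?_⟩
    · have h1 : (h⁻¹ * g) • r.1 = s.1 := by
        rw [mul_smul, inv_smul_eq_iff]
        exact hp
      obtain ⟨h2, h3⟩ := rep_unique r s _ h1
      rw [inv_mul_eq_one] at h2
      rw [h2, h3]
    · obtain ⟨r, g, h⟩ := exists_smul_rep A
      exact ⟨(r, g), h⟩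

@[simp]
lemma repEquiv_apply [NeZero m] (r : Rep m) (g : SL(2, ℤ)) : repEquiv m (r, g) = g • r.1 := rfl

/-- A sum over the left cosets is unchanged by right multiplication. -/
lemma sum_mulRight [NeZero m] {M : Type*} [AddCommMonoid M] (F : DetMatrix m → M)
    (hF : ∀ (g : SL(2, ℤ)) A, F (g • A) = F A) (h : SL(2, ℤ)) :
    ∑ r : Rep m, F (mulRight r.1 h) = ∑ r : Rep m, F r.1 := by
  have hex (r : Rep m) : ∃ (s : Rep m) (g : SL(2, ℤ)), g • s.1 = mulRight r.1 h :=
    exists_smul_rep _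
  choose σ g hg using hex
  -- If two translates share a coset, cancelling `h` on the right puts `r` and `s` in the same
  -- coset.
  have hσ : Function.Injective σ := by
    intro r s hrs
    have h1 : mulRight ((g s * (g r)⁻¹) • r.1) h = mulRight s.1 h := by
      rw [← smul_mulRight, ← hg, ← hg, hrs, mul_smul, inv_smul_smul]
    have h2 := congrArg (fun A => mulRight A h⁻¹) h1
    simp only [← mulRight_mul, mul_inv_cancel, mulRight_one] at h2
    exact (rep_unique _ _ _ h2).2
  have hb : Function.Bijective σ := Finite.injective_iff_bijective.1 hσ
  rw [← hb.sum_comp (fun r : Rep m => F r.1)]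
  refine Finset.sum_congr rfl fun r _ => ?_
  rw [← hg, hF]

end DetMatrix

lemma weightPos_rep {k : ℤ} {m : ℕ} (r : Rep m) : weightPos k r.1 =
    zeta (k * (r.1.1 0 1 * r.1.1 1 1) - 3 * (k * (r.1.1 1 1 - 1))) := by
  rw [weightPos, r.2.1, charExp]
  congr 1
  ring

lemma charExp_zmod_three_of_zero : ∀ k a d : ZMod 3, k * (a * d) = -k →
    k * (6 * d + 6) = 0 := by
  decide +kernel

lemma charExp_zmod_four_of_zero : ∀ k a d : ZMod 4, k * (a * d) = -k →
    k * (6 * d + 6) = 0 := by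
  decide +kernel

/-- The two exponents differ by `6k(d + 1)`. This vanishes modulo 12: if `k` is odd, then `k * ad ≡
-k` forces `d` to be odd. The shift by 6 in `weightNeg` is what makes the normalizations agree. -/
lemma weightNeg_rep {k : ℤ} {m : ℕ} (h : k * m ≡ -k [ZMOD 12]) (r : Rep m) : weightNeg k r.1 =
    zeta (k * (r.1.1 0 1 * r.1.1 1 1) - 3 * (k * (r.1.1 1 1 - 1))) := by
  have h1 := h.symm.dvd
  rw [← det_eq r.1, r.2.1, twelve_dvd_iff] at h1
  push_cast [mul_zero, sub_zero, sub_neg_eq_add, add_eq_zero_iff_eq_neg] at h1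
  rw [weightNeg, r.2.1]
  apply zeta_congr
  rw [show k * (charExp (r.1.1 0 0) (-r.1.1 0 1) 0 (-r.1.1 1 1) + 6) -
    (k * (r.1.1 0 1 * r.1.1 1 1) - 3 * (k * (r.1.1 1 1 - 1))) = k * (6 * r.1.1 1 1 + 6) by
      rw [charExp]; ring, twelve_dvd_iff]
  push_cast
  exact ⟨charExp_zmod_three_of_zero _ _ _ h1.1, charExp_zmod_four_of_zero _ _ _ h1.2⟩

/-- Says that `χ_k(d) = ±1` for `d` dividing `m`, so conjugating the weight leaves this factor
unchanged. -/
lemma zeta_three_mul_neg {k : ℤ} {m : ℕ} (h : k * m ≡ -k [ZMOD 12]) (r : Rep m) :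
    zeta (-(3 * (k * (r.1.1 1 1 - 1)))) = zeta (3 * (k * (r.1.1 1 1 - 1))) := by
  have h1 := h.symm.dvd
  rw [← det_eq r.1, r.2.1, twelve_dvd_iff] at h1
  push_cast [mul_zero, sub_zero, sub_neg_eq_add, add_eq_zero_iff_eq_neg] at h1
  have h2 : 12 ∣ k * (6 * r.1.1 1 1 + 6) := by
    rw [twelve_dvd_iff]
    push_cast
    exact ⟨charExp_zmod_three_of_zero _ _ _ h1.1, charExp_zmod_four_of_zero _ _ _ h1.2⟩
  apply zeta_congr
  rw [show -(3 * (k * (r.1.1 1 1 - 1))) - 3 * (k * (r.1.1 1 1 - 1)) =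
    -(k * (6 * r.1.1 1 1 + 6)) + 12 * k by ring]
  exact dvd_add (dvd_neg.2 h2) (dvd_mul_right _ _)

/-! ### The action of integral matrices of positive determinant -/

namespace DetMatrix

variable {m : ℕ} [NeZero m]

/-- An integral matrix of positive determinant as a real invertible matrix. -/
def toGL (A : DetMatrix m) : GL (Fin 2) ℝ :=
  Matrix.GeneralLinearGroup.mkOfDetNeZero (A.1.map (Int.cast : ℤ → ℝ)) <| by
    have h : (A.1.map (Int.cast : ℤ → ℝ)).det = m := by
      have := A.1.det_fin_two
      rw [A.2] at this
      rw [Matrix.det_fin_two]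
      simp only [Matrix.map_apply]
      exact_mod_cast this.symm
    rw [h]
    exact_mod_cast NeZero.ne m

lemma toGL_apply (A : DetMatrix m) (i j : Fin 2) : toGL A i j = A.1 i j := rfl

lemma det_toGL (A : DetMatrix m) : (toGL A).det.val = m := by
  have := A.1.det_fin_two
  rw [A.2] at this
  rw [Matrix.GeneralLinearGroup.val_det_apply, Matrix.det_fin_two]
  simp only [toGL_apply]
  exact_mod_cast this.symm

lemma det_toGL_pos (A : DetMatrix m) : 0 < (toGL A).det.val := by
  rw [det_toGL]
  exact_mod_cast NeZero.pos m

lemma toGL_smul (g : SL(2, ℤ)) (A : DetMatrix m) : toGL (g • A) = (g : GL (Fin 2) ℝ) * toGL A := by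
  ext i j
  have h := @FixedDetMatrices.smul_coe (Fin 2) _ _ ℤ _ (m : ℤ) g A
  rw [Matrix.GeneralLinearGroup.coe_mul, Matrix.mul_apply]
  change (((g • A).1 i j : ℤ) : ℝ) = _
  rw [h, Matrix.mul_apply]
  push_cast
  rfl

lemma toGL_mulRight (A : DetMatrix m) (g : SL(2, ℤ)) :
    toGL (mulRight A g) = toGL A * (g : GL (Fin 2) ℝ) := by
  ext i j
  rw [Matrix.GeneralLinearGroup.coe_mul, Matrix.mul_apply]
  change (((A.1 * g.1) i j : ℤ) : ℝ) = _
  rw [Matrix.mul_apply]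
  push_cast
  rfl

lemma toGL_adj_mul (A : DetMatrix m) : toGL (adj A) * toGL A =
    Matrix.GeneralLinearGroup.scalar (Fin 2) (Units.mk0 (m : ℝ) (by exact_mod_cast NeZero.ne m)) := by
  have hd : ((A.1 0 0 : ℤ) : ℝ) * A.1 1 1 - A.1 0 1 * A.1 1 0 = m := by exact_mod_cast det_eq A
  obtain ⟨h1, h2, h3, h4⟩ := adj_entries A
  ext i j
  change _ = Matrix.scalar (Fin 2) (m : ℝ) i j
  rw [Matrix.GeneralLinearGroup.coe_mul, Matrix.mul_apply, Matrix.scalar_apply, Fin.sum_univ_two,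
    toGL_apply, toGL_apply, toGL_apply, toGL_apply, Matrix.diagonal_apply, ← hd]
  fin_cases i <;> fin_cases j <;> simp [h1, h2, h3, h4] <;> ring

end DetMatrix

/-! ### Hecke operators as sums over cosets -/

/-- `phase k w = exp(i k Arg w)`. -/
def phase (k : ℤ) (w : ℂ) : ℂ := Complex.exp (Complex.I * k * Complex.arg w)

/-- For integral `k` the branch cut of `Arg` is invisible; this is what makes `phase`
multiplicative. -/
lemma phase_eq (k : ℤ) {w : ℂ} (hw : w ≠ 0) : phase k w = (w / ‖w‖) ^ k := by
  have h := Complex.norm_mul_exp_arg_mul_I w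
  have hw' : (‖w‖ : ℂ) ≠ 0 := by simpa using hw
  have h1 : w / ‖w‖ = Complex.exp (Complex.arg w * Complex.I) := by
    rw [div_eq_iff hw', mul_comm, h]
  rw [h1, phase, ← Complex.exp_int_mul]
  congr 1
  ring

lemma phase_mul (k : ℤ) {w₁ w₂ : ℂ} (h₁ : w₁ ≠ 0) (h₂ : w₂ ≠ 0) :
    phase k (w₁ * w₂) = phase k w₁ * phase k w₂ := by
  rw [phase_eq k h₁, phase_eq k h₂, phase_eq k (mul_ne_zero h₁ h₂), ← mul_zpow, norm_mul]
  congr 1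
  push_cast
  rw [mul_div_mul_comm]

lemma phase_ofReal (k : ℤ) {x : ℝ} (hx : 0 < x) : phase k x = 1 := by
  simp [phase, Complex.arg_ofReal_of_nonneg hx.le]

@[simp] lemma norm_phase (k : ℤ) (w : ℂ) : ‖phase k w‖ = 1 := by
  rw [phase, show Complex.I * k * Complex.arg w = ((k * Complex.arg w : ℝ) : ℂ) * Complex.I by
    push_cast
    ring, Complex.norm_exp_ofReal_mul_I]

lemma phase_ne_zero (k : ℤ) (w : ℂ) : phase k w ≠ 0 := Complex.exp_ne_zero _

/-- The weight `k` action of a real matrix. -/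
def realSlash (k : ℤ) (g : GL (Fin 2) ℝ) (f : ℍ → ℂ) (z : ℍ) : ℂ :=
  (phase k (denom g z))⁻¹ * f (g • z)

lemma slash_eq_realSlash (k : ℤ) (g : SL(2, ℤ)) (f : ℍ → ℂ) (z : ℍ) :
    slash k g f z = realSlash k g f z := rfl

lemma phase_denom_mul (k : ℤ) (g h : GL (Fin 2) ℝ) (hh : 0 < h.det.val) (z : ℍ) :
    phase k (denom (g * h) z) = phase k (denom g ((h • z : ℍ) : ℂ)) * phase k (denom h z) := by
  rw [denom_cocycle_σ, σ, if_pos hh, ContinuousAlgEquiv.refl_apply,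
    phase_mul k (denom_ne_zero _ _) (denom_ne_zero _ _)]

lemma realSlash_mul (k : ℤ) (g h : GL (Fin 2) ℝ) (hh : 0 < h.det.val) (f : ℍ → ℂ) (z : ℍ) :
    realSlash k (g * h) f z = (phase k (denom h z))⁻¹ * realSlash k g f (h • z) := by
  rw [realSlash, realSlash, phase_denom_mul k g h hh, mul_smul, mul_inv]
  ring

lemma det_coe_pos (g : SL(2, ℤ)) : 0 < (g : GL (Fin 2) ℝ).det.val := by simp

lemma IsHeckeWeight.ne_zero {m : ℕ} {v v' : SL(2, ℤ) → ℂ} {w : DetMatrix m → ℂ}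
    (hw : IsHeckeWeight v v' w) (A : DetMatrix m) : w A ≠ 0 := by
  intro h
  simpa [h] using hw.norm_eq A

lemma sum_divisorsAntidiagonal_range {m : ℕ} {M : Type*} [AddCommMonoid M] (hm : 0 < m)
    (G : ℕ → ℕ → ℕ → M) :
    ∑ p ∈ m.divisorsAntidiagonal, ∑ b ∈ Finset.range p.2, G p.1 b p.2 =
      ∑ r : Rep m, G (r.1.1 0 0).toNat (r.1.1 0 1).toNat (r.1.1 1 1).toNat := by
  rw [Finset.sum_sigma']
  symm
  refine Finset.sum_bij
    (fun r _ => ⟨((r.1.1 0 0).toNat, (r.1.1 1 1).toNat), (r.1.1 0 1).toNat⟩) ?_ ?_ ?_ ?_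
  · intro r _
    have hd := rep_d_pos r
    have hdet := det_eq r.1
    obtain ⟨A, h10, h00, h01, h11⟩ := r
    simp only at hd hdet ⊢
    rw [h10, mul_zero, sub_zero] at hdet
    rw [abs_of_nonneg h01, abs_of_pos hd] at h11
    rw [Finset.mem_sigma, Nat.mem_divisorsAntidiagonal, Finset.mem_range]
    refine ⟨⟨?_, hm.ne'⟩, by simp only; omega⟩
    zify
    rw [Int.toNat_of_nonneg h00.le, Int.toNat_of_nonneg hd.le, hdet]
  · intro r _ s _ h
    have hdr := rep_d_pos r
    have hds := rep_d_pos s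
    obtain ⟨A, a10, a00, a01, a11⟩ := r
    obtain ⟨B, b10, b00, b01, b11⟩ := s
    simp only [Sigma.mk.injEq, Prod.mk.injEq, heq_eq_eq] at h hdr hds
    obtain ⟨⟨h1, h2⟩, h3⟩ := h
    apply Subtype.ext
    apply FixedDetMatrices.ext
    intro i j
    fin_cases i <;> fin_cases j <;> simp <;> omega
  · rintro ⟨⟨a, d⟩, b⟩ h
    rw [Finset.mem_sigma, Nat.mem_divisorsAntidiagonal, Finset.mem_range] at h
    obtain ⟨⟨h1, h2⟩, h3⟩ := h
    simp only at h1 h3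
    have ha : 0 < a := Nat.pos_of_ne_zero (by rintro rfl; simp at h1; omega)
    refine ⟨⟨⟨!![(a : ℤ), b; 0, d], by simp [Matrix.det_fin_two, ← h1]⟩, ?_⟩, Finset.mem_univ _, ?_⟩
    · exact ⟨by simp, by simpa using ha, by simp, by simpa using h3⟩
    · simp
  · intro r _
    rfl

section

variable {m : ℕ} [NeZero m]

/-- The summand of a Hecke operator at an integral matrix. -/
def heckeTerm (k : ℤ) (w : DetMatrix m → ℂ) (f : ℍ → ℂ) (A : DetMatrix m) (z : ℍ) : ℂ :=
  (w A)⁻¹ * realSlash k (toGL A) f z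

/-- The Hecke operator attached to a weight, as a sum over the left cosets. -/
def heckeSum (k : ℤ) (w : DetMatrix m → ℂ) (f : ℍ → ℂ) (z : ℍ) : ℂ :=
  (1 / (Real.sqrt m : ℂ)) * ∑ r : Rep m, heckeTerm k w f r.1 z

lemma IsHeckeWeight.heckeTerm_smul {v v' : SL(2, ℤ) → ℂ} {w : DetMatrix m → ℂ}
    (hw : IsHeckeWeight v v' w) {k : ℤ} {f : ℍ → ℂ}
    (hf : ∀ (g : SL(2, ℤ)) (z : ℍ), slash k g f z = v g * f z) (g : SL(2, ℤ)) (A : DetMatrix m)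
    (z : ℍ) : heckeTerm k w f (g • A) z = heckeTerm k w f A z := by
  have hv : v g ≠ 0 := by
    have h := hw.ne_zero (g • A)
    rw [hw.left] at h
    exact left_ne_zero_of_mul h
  rw [heckeTerm, heckeTerm, toGL_smul, realSlash_mul _ _ _ (det_toGL_pos A), ← slash_eq_realSlash,
    hf, hw.left, realSlash]
  field_simp

lemma IsHeckeWeight.heckeTerm_mulRight {v v' : SL(2, ℤ) → ℂ} {w : DetMatrix m → ℂ}
    (hw : IsHeckeWeight v v' w) (k : ℤ) (f : ℍ → ℂ) (g : SL(2, ℤ)) (A : DetMatrix m) (z : ℍ) :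
    v' g * heckeTerm k w f (mulRight A g) z = (autoFactor k g z)⁻¹ * heckeTerm k w f A (g • z) := by
  have hv : v' g ≠ 0 := by
    have h := hw.ne_zero (mulRight A g)
    rw [hw.right] at h
    exact right_ne_zero_of_mul h
  rw [heckeTerm, heckeTerm, toGL_mulRight, realSlash_mul _ _ _ (det_coe_pos g), hw.right,
    show autoFactor k g z = phase k (denom g z) from rfl, mul_inv]
  change v' g * ((w A)⁻¹ * (v' g)⁻¹ * (_ * realSlash k (toGL A) f (g • z))) = _
  field_simp

lemma IsHeckeWeight.slash_heckeSum {v v' : SL(2, ℤ) → ℂ} {w : DetMatrix m → ℂ}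
    (hw : IsHeckeWeight v v' w) {k : ℤ} {f : ℍ → ℂ}
    (hf : ∀ (g : SL(2, ℤ)) (z : ℍ), slash k g f z = v g * f z) (g : SL(2, ℤ)) (z : ℍ) :
    slash k g (heckeSum k w f) z = v' g * heckeSum k w f z := by
  have h := sum_mulRight (fun A => heckeTerm k w f A z)
    (fun g A => hw.heckeTerm_smul hf g A z) g
  rw [slash, heckeSum, heckeSum, ← h, mul_left_comm, mul_left_comm (v' g), Finset.mul_sum,
    Finset.mul_sum (a := v' g)]
  congr 1
  exact Finset.sum_congr rfl fun r _ => (hw.heckeTerm_mulRight k f g r.1 z).symm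

lemma toGL_rep_smul (r : Rep m) (z : ℍ) : toGL r.1 • z =
    ofComplex (((r.1.1 0 0).toNat * (z : ℂ) + (r.1.1 0 1).toNat) / (r.1.1 1 1).toNat) := by
  have h0 : ((r.1.1 0 0).toNat : ℂ) = ((r.1.1 0 0 : ℤ) : ℂ) := by
    exact_mod_cast Int.toNat_of_nonneg r.2.2.1.le
  have h1 : ((r.1.1 0 1).toNat : ℂ) = ((r.1.1 0 1 : ℤ) : ℂ) := by
    exact_mod_cast Int.toNat_of_nonneg r.2.2.2.1
  have h2 : ((r.1.1 1 1).toNat : ℂ) = ((r.1.1 1 1 : ℤ) : ℂ) := by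
    exact_mod_cast Int.toNat_of_nonneg (rep_d_pos r).le
  have h := coe_smul_of_det_pos (det_toGL_pos r.1) z
  rw [num, denom, toGL_apply, toGL_apply, toGL_apply, toGL_apply, r.2.1] at h
  rw [h0, h1, h2]
  have h3 : ((toGL r.1 • z : ℍ) : ℂ) = ((r.1.1 0 0 : ℤ) * (z : ℂ) + (r.1.1 0 1 : ℤ)) / (r.1.1 1 1 : ℤ) := by
    rw [h]
    simp
  rw [← h3, ofComplex_apply]

/-- The automorphy factor is trivial because the denominator is the positive number `d`. -/
lemma realSlash_rep (k : ℤ) (r : Rep m) (f : ℍ → ℂ) (z : ℍ) :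
    realSlash k (toGL r.1) f z = f (toGL r.1 • z) := by
  have h : denom (toGL r.1) z = ((r.1.1 1 1 : ℝ) : ℂ) := by
    rw [denom, toGL_apply, toGL_apply, r.2.1]
    simp
  rw [realSlash, h, phase_ofReal k (by exact_mod_cast rep_d_pos r), inv_one, one_mul]

lemma hecke_apply (v : SL(2, ℤ) → ℂ) (k : ℤ) (w : DetMatrix m → ℂ) (f : ℍ → ℂ) (z : ℍ)
    (hw : ∀ r : Rep m, (w r.1)⁻¹ = zeta (3 * (k * (r.1.1 1 1 - 1))) *
      v ModularGroup.T ^ (-(r.1.1 0 1 * r.1.1 1 1))) :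
    hecke v k m f z = heckeSum k w f z := by
  have h := sum_divisorsAntidiagonal_range (m := m) (NeZero.pos m) (fun a b d =>
    chi k d * (v ModularGroup.T ^ (-((b : ℤ) * d)) * f (ofComplex ((a * (z : ℂ) + b) / d))))
  simp only [← Finset.mul_sum] at h
  change (1 / (Real.sqrt m : ℂ)) * _ = _
  rw [h, heckeSum]
  congr 1
  refine Finset.sum_congr rfl fun r _ => ?_
  rw [heckeTerm, realSlash_rep, toGL_rep_smul, hw, chi_eq, Int.toNat_of_nonneg (rep_d_pos r).le,
    Int.toNat_of_nonneg r.2.2.2.1, mul_assoc]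

lemma hecke_multiplier_pos (k : ℤ) (f : ℍ → ℂ) :
    hecke (multiplier k) k m f = heckeSum k (weightPos (m := m) k) f := by
  funext z
  refine hecke_apply _ _ _ _ _ fun r => ?_
  rw [weightPos_rep, multiplier_T, ← zeta_mul, ← zeta_add, ← zeta_neg]
  congr 1
  ring

lemma hecke_multiplier_neg {k : ℤ} (h : k * m ≡ -k [ZMOD 12]) (f : ℍ → ℂ) :
    hecke (multiplier k) k m f = heckeSum k (weightNeg (m := m) k) f := by
  funext z
  refine hecke_apply _ _ _ _ _ fun r => ?_
  rw [weightNeg_rep h, multiplier_T, ← zeta_mul, ← zeta_add, ← zeta_neg]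
  congr 1
  ring

lemma hecke_conjMultiplier {k : ℤ} (h : k * m ≡ -k [ZMOD 12]) (f : ℍ → ℂ) :
    hecke (conjMultiplier (multiplier k)) k m f =
      heckeSum k (fun A : DetMatrix m => conj (weightNeg k A)) f := by
  funext z
  refine hecke_apply _ _ _ _ _ fun r => ?_
  rw [weightNeg_rep h, conjMultiplier, multiplier_T, conj_zeta, conj_zeta, ← zeta_mul,
    ← zeta_three_mul_neg h, ← zeta_add, ← zeta_neg]
  congr 1
  ring

end

/-! ### The Laplacian and affine maps -/

lemma laplacian_comp_affine (h : ℂ → ℂ) {α : ℝ} (hα : α ≠ 0) (β : ℂ) (z : ℂ) :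
    Laplacian.laplacian (fun w : ℂ => h (α • w + β)) z =
      (α : ℂ) ^ 2 * Laplacian.laplacian h (α • z + β) := by
  let e : ℂ ≃L[ℝ] ℂ := ContinuousLinearEquiv.smulLeft (Units.mk0 α hα)
  have he (w : ℂ) : e w = α • w := rfl
  have key (v : Fin 2 → ℂ) : iteratedFDeriv ℝ 2 (fun w : ℂ => h (α • w + β)) z v =
      (α : ℂ) ^ 2 * iteratedFDeriv ℝ 2 h (α • z + β) v := by
    have h1 := e.iteratedFDerivWithin_comp_right (fun w => h (w + β)) uniqueDiffOn_univ
      (x := z) (Set.mem_univ _) 2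
    simp only [Set.preimage_univ, iteratedFDerivWithin_univ] at h1
    rw [iteratedFDeriv_comp_add_right] at h1
    change iteratedFDeriv ℝ 2 ((fun w => h (w + β)) ∘ e) z v = _
    rw [h1]
    change iteratedFDeriv ℝ 2 h (α • z + β) (fun i => α • v i) = _
    rw [ContinuousMultilinearMap.map_smul_univ]
    simp [sq]
  rw [InnerProductSpace.laplacian_eq_iteratedFDeriv_complexPlane,
    InnerProductSpace.laplacian_eq_iteratedFDeriv_complexPlane]
  simp only [key]
  ring

/-- The `C²` solutions of `Δ_k f = c f`. -/
def eigenSpace (k : ℤ) (c : ℂ) : Submodule ℂ (ℍ → ℂ) where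
  carrier := {f | (∀ z : ℍ, ContDiffAt ℝ 2 (f ∘ ofComplex) (z : ℂ)) ∧
    ∀ z : ℍ, weightLaplacian k f z + c * f z = 0}
  zero_mem' := by
    have h0 : ((0 : ℍ → ℂ) ∘ ofComplex) = fun _ => (0 : ℂ) := rfl
    refine ⟨fun z => ?_, fun z => ?_⟩
    · rw [h0]; exact contDiffAt_const
    · simp [weightLaplacian, h0]
  add_mem' := by
    rintro f g ⟨hf1, hf3⟩ ⟨hg1, hg3⟩
    have h0 : (f + g) ∘ ofComplex = f ∘ ofComplex + g ∘ ofComplex := rfl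
    refine ⟨fun z => ?_, fun z => ?_⟩
    · rw [h0]; exact (hf1 z).add (hg1 z)
    · have h1 := hf3 z
      have h2 := hg3 z
      have h3 := (hf1 z).laplacian_add (hg1 z)
      have h4 := fderiv_add ((hf1 z).differentiableAt (by norm_num))
        ((hg1 z).differentiableAt (by norm_num))
      simp only [weightLaplacian, h0, h3, h4, Pi.add_apply, add_apply] at *
      linear_combination h1 + h2
  smul_mem' := by
    rintro a f ⟨hf1, hf3⟩
    have h0 : (a • f) ∘ ofComplex = a • (f ∘ ofComplex) := rfl
    refine ⟨fun z => ?_, fun z => ?_⟩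
    · rw [h0]; exact contDiffAt_const.smul (hf1 z)
    · have h1 := hf3 z
      have h3 := InnerProductSpace.laplacian_smul a (hf1 z)
      have h4 := fderiv_const_smul ((hf1 z).differentiableAt (by norm_num)) a
      simp only [weightLaplacian, h0, h3, h4, Pi.smul_apply, smul_eq_mul,
        smul_apply] at *
      linear_combination a * h1

/-- Under `z ↦ αz + β` with `α > 0` and `β` real, each derivative produces a factor `α` that is
absorbed by `y ↦ αy`, so both terms of `Δ_k` are invariant. -/
lemma eigenSpace_comp_affine {k : ℤ} {c : ℂ} {f : ℍ → ℂ} (hf : f ∈ eigenSpace k c) {α : ℝ}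
    (hα : 0 < α) (β : ℝ) {φ : ℍ → ℍ} (hφ : ∀ z : ℍ, (φ z : ℂ) = α • (z : ℂ) + β) :
    (fun z => f (φ z)) ∈ eigenSpace k c := by
  have heq (z : ℍ) : ((fun z => f (φ z)) ∘ ofComplex) =ᶠ[nhds (z : ℂ)]
      fun w => (f ∘ ofComplex) (α • w + β) := by
    filter_upwards [isOpen_upperHalfPlaneSet.mem_nhds z.2] with w hw
    change f (φ (ofComplex w)) = f (ofComplex (α • w + β))
    have h1 := hφ (ofComplex w)
    rw [ofComplex_apply_of_im_pos hw] at h1 ⊢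
    change _ = α • w + β at h1
    rw [← h1, ofComplex_apply]
  have haff (z : ℍ) : ContDiffAt ℝ 2 (fun w : ℂ => α • w + (β : ℂ)) z := by fun_prop
  have hcd (z : ℍ) : ContDiffAt ℝ 2 (f ∘ ofComplex) (α • (z : ℂ) + β) := by
    rw [← hφ]
    exact hf.1 _
  refine ⟨fun z => ?_, fun z => ?_⟩
  · exact ((hcd z).comp (z : ℂ) (haff z)).congr_of_eventuallyEq (heq z)
  · have h1 := (InnerProductSpace.laplacian_congr_nhds (heq z)).eq_of_nhds
    rw [laplacian_comp_affine _ hα.ne'] at h1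
    have hd : HasFDerivAt (fun w : ℂ => α • w + (β : ℂ)) (α • ContinuousLinearMap.id ℝ ℂ) (z : ℂ) :=
      ((hasFDerivAt_id (z : ℂ)).const_smul α).add_const _
    have h2 : fderiv ℝ ((fun z => f (φ z)) ∘ ofComplex) (z : ℂ) 1 =
        α * fderiv ℝ (f ∘ ofComplex) (φ z : ℂ) 1 := by
      rw [(heq z).fderiv_eq, hφ]
      have h3 := (((hcd z).differentiableAt (by norm_num)).hasFDerivAt).comp (z : ℂ) hd
      change fderiv ℝ ((f ∘ ofComplex) ∘ fun w : ℂ => α • w + (β : ℂ)) (z : ℂ) 1 = _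
      rw [h3.fderiv]
      simp
    have h4 := hf.2 (φ z)
    have him : (φ z).im = α * z.im := by
      have := congrArg Complex.im (hφ z)
      simpa using this
    rw [weightLaplacian, him, hφ] at h4
    rw [weightLaplacian, h1, h2, hφ, ← h4]
    push_cast
    ring

section

variable {m : ℕ} [NeZero m]

lemma coe_toGL_rep_smul (r : Rep m) (z : ℍ) : ((toGL r.1 • z : ℍ) : ℂ) =
    ((r.1.1 0 0 : ℝ) / (r.1.1 1 1 : ℝ)) • (z : ℂ) +
      (((r.1.1 0 1 : ℝ) / (r.1.1 1 1 : ℝ) : ℝ) : ℂ) := by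
  rw [coe_smul_of_det_pos (det_toGL_pos r.1), num, denom, toGL_apply, toGL_apply, toGL_apply,
    toGL_apply, r.2.1]
  have h : ((r.1.1 1 1 : ℤ) : ℂ) ≠ 0 := by exact_mod_cast (rep_d_pos r).ne'
  simp
  field_simp

lemma heckeSum_mem_eigenSpace {k : ℤ} {c : ℂ} {f : ℍ → ℂ} (hf : f ∈ eigenSpace k c)
    (w : DetMatrix m → ℂ) : heckeSum k w f ∈ eigenSpace k c := by
  have h : heckeSum k w f = (1 / (Real.sqrt m : ℂ)) •
      ∑ r : Rep m, (w r.1)⁻¹ • fun z => f (toGL r.1 • z) := by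
    funext z
    simp only [heckeSum, heckeTerm, realSlash_rep, Pi.smul_apply, Finset.sum_apply, smul_eq_mul]
  rw [h]
  refine Submodule.smul_mem _ _ (Submodule.sum_mem _ fun r _ => Submodule.smul_mem _ _ ?_)
  refine eigenSpace_comp_affine hf ?_ _ (coe_toGL_rep_smul r)
  have h1 : (0 : ℝ) < r.1.1 0 0 := by exact_mod_cast r.2.2.1
  have h2 : (0 : ℝ) < r.1.1 1 1 := by exact_mod_cast rep_d_pos r
  positivity

end

/-! ### Unfolding over the modular group -/

lemma volume_coe_preimage_eq_zero {s : Set ℂ} (hs : volume s = 0) :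
    volume ((↑) ⁻¹' s : Set ℍ) = 0 := by
  rw [volume_eq_lintegral]
  refine setLIntegral_measure_zero _ _ (measure_mono_null ?_ hs)
  exact Set.image_preimage_subset _ _

lemma volume_fd_diff_fdo : volume (ModularGroup.fd \ ModularGroup.fdo) = 0 := by
  have hline (c : ℝ) : volume {w : ℂ | w.re = c} = 0 := by
    have h := (convex_halfSpace_re_lt c).addHaar_frontier (volume : Measure ℂ)
    rwa [Complex.frontier_setOfPred_re_lt] at h
  have hsph : volume (Metric.sphere (0 : ℂ) 1) = 0 := Measure.addHaar_sphere _ _ _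
  have hsub : ModularGroup.fd \ ModularGroup.fdo ⊆
      (↑) ⁻¹' (Metric.sphere (0 : ℂ) 1 ∪ ({w : ℂ | w.re = 1 / 2} ∪ {w : ℂ | w.re = -(1 / 2)})) := by
    rintro z ⟨⟨h1, h2⟩, h3⟩
    by_contra h4
    simp only [Set.mem_preimage, Set.mem_union, Set.mem_ofPred_eq, not_or, mem_sphere_zero_iff_norm,
      coe_re] at h4
    apply h3
    refine ⟨lt_of_le_of_ne h1 fun h => h4.1 ?_, lt_of_le_of_ne h2 fun h => ?_⟩
    · rw [Complex.normSq_eq_norm_sq] at h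
      exact (pow_eq_one_iff_of_nonneg (norm_nonneg _) two_ne_zero).1 h.symm
    · rcases abs_cases z.re with h5 | h5
      · exact h4.2.1 (by rw [← h5.1, h])
      · exact h4.2.2 (by linarith)
  refine measure_mono_null hsub (volume_coe_preimage_eq_zero ?_)
  rw [measure_union_null_iff, measure_union_null_iff]
  exact ⟨hsph, hline _, hline _⟩

instance : Countable SL(2, ℤ) := by
  have : Countable (Matrix (Fin 2) (Fin 2) ℤ) := inferInstanceAs (Countable (Fin 2 → Fin 2 → ℤ))
  exact Subtype.countable

lemma ae_forall_mem_fdo (g : GL (Fin 2) ℝ) : ∀ᵐ z : ℍ, ∀ γ : SL(2, ℤ),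
    γ • g • z ∈ ModularGroup.fd → γ • g • z ∈ ModularGroup.fdo := by
  rw [ae_all_iff]
  intro γ
  have h : {z : ℍ | ¬ (γ • g • z ∈ ModularGroup.fd → γ • g • z ∈ ModularGroup.fdo)} =
      (((γ : GL (Fin 2) ℝ) * g) • ·) ⁻¹' (ModularGroup.fd \ ModularGroup.fdo) := by
    ext z
    simp only [Set.mem_ofPred_eq, Classical.not_imp, Set.mem_preimage, mul_smul]
    rfl
  rw [ae_iff, h, measure_preimage_smul, volume_fd_diff_fdo]

/-- The points of the fundamental domain that `g` maps into the fundamental domain. -/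
def fdInter (g : GL (Fin 2) ℝ) : Set ℍ := ModularGroup.fd ∩ (g • ·) ⁻¹' ModularGroup.fd

lemma measurableSet_fd : MeasurableSet ModularGroup.fd := ModularGroup.isClosed_fd.measurableSet

/-- The count is 2 rather than 1 because `γ` and `-γ` act identically; off the boundary of the
domain there are no other coincidences. -/
lemma tsum_indicator_fd {z : ℍ} (hz : ∀ γ : SL(2, ℤ),
    γ • z ∈ ModularGroup.fd → γ • z ∈ ModularGroup.fdo) :
    ∑' γ : SL(2, ℤ), ModularGroup.fd.indicator (1 : ℍ → ENNReal) (γ • z) = 2 := by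
  obtain ⟨γ₀, h0⟩ := ModularGroup.exists_smul_mem_fd z
  have h1 (γ : SL(2, ℤ)) (h : γ • z ∈ ModularGroup.fd) : γ = γ₀ ∨ γ = -γ₀ := by
    have h2 : (γ * γ₀⁻¹) • (γ₀ • z) ∈ ModularGroup.fd := by rwa [mul_smul, inv_smul_smul]
    rcases ModularGroup.eq_one_or_neg_one_of_mem_fdo_mem_fd (hz _ h0) h2 with h3 | h3
    · exact Or.inl (mul_inv_eq_one.1 h3)
    · right
      rw [mul_inv_eq_iff_eq_mul] at h3
      rw [h3, neg_mul, one_mul]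
  have hne : γ₀ ≠ -γ₀ := by
    intro h
    have h2 : (1 : SL(2, ℤ)) = -1 := by
      have := congrArg (γ₀⁻¹ * ·) h
      simpa using this
    have h3 := congrArg (fun γ : SL(2, ℤ) => γ.1 0 0) h2
    simp at h3
  classical
  rw [tsum_eq_sum (s := {γ₀, -γ₀}), Finset.sum_pair hne]
  · rw [ModularGroup.SL_neg_smul, Set.indicator_of_mem h0]
    norm_num
  · intro γ hγ
    apply Set.indicator_of_notMem
    intro h
    simp only [Finset.mem_insert, Finset.mem_singleton] at hγ
    exact hγ (h1 γ h)

/-- For almost every `z`, exactly two `γ` carry `gz` into the fundamental domain. -/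
lemma sum_restrict_fdInter (g : GL (Fin 2) ℝ) :
    Measure.sum (fun γ : SL(2, ℤ) => volume.restrict (fdInter ((γ : GL (Fin 2) ℝ) * g))) =
      (2 : ENNReal) • volume.restrict ModularGroup.fd := by
  ext s hs
  rw [Measure.sum_apply _ hs, Measure.smul_apply, Measure.restrict_apply hs, smul_eq_mul]
  have h (γ : SL(2, ℤ)) : volume.restrict (fdInter ((γ : GL (Fin 2) ℝ) * g)) s =
      ∫⁻ z in s ∩ ModularGroup.fd, ModularGroup.fd.indicator (1 : ℍ → ENNReal) (γ • g • z) := by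
    have h1 : (fun z : ℍ => ModularGroup.fd.indicator (1 : ℍ → ENNReal) (γ • g • z)) =
        ((((γ : GL (Fin 2) ℝ) * g) • ·) ⁻¹' ModularGroup.fd).indicator 1 := by
      funext z
      rw [show γ • g • z = ((γ : GL (Fin 2) ℝ) * g) • z from (mul_smul (γ : GL (Fin 2) ℝ) g z).symm]
      rfl
    rw [h1, lintegral_indicator_one
      (measurableSet_fd.preimage (continuous_const_smul _).measurable),
      Measure.restrict_apply hs, Measure.restrict_apply
      (measurableSet_fd.preimage (continuous_const_smul _).measurable), fdInter]
    congr 1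
    ext z
    simp only [Set.mem_inter_iff]
    tauto
  simp only [h]
  rw [← lintegral_tsum]
  · rw [lintegral_congr_ae (g := fun _ => 2), setLIntegral_const]
    exact ae_restrict_of_ae ((ae_forall_mem_fdo g).mono fun z hz => tsum_indicator_fd hz)
  · intro γ
    have hm : Measurable fun z : ℍ => γ • g • z :=
      ((continuous_const_smul (γ : GL (Fin 2) ℝ)).comp (continuous_const_smul g)).measurable
    exact ((measurable_one.indicator measurableSet_fd).comp hm).aemeasurable

section

variable {m : ℕ} [NeZero m]

lemma lintegral_fd_eq_tsum (Φ : DetMatrix m → ℍ → ENNReal)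
    (hΦ : ∀ (g : SL(2, ℤ)) A z, Φ (g • A) z = Φ A z) :
    2 * ∑ r : Rep m, ∫⁻ z in ModularGroup.fd, Φ r.1 z =
      ∑' A : DetMatrix m, ∫⁻ z in fdInter (toGL A), Φ A z := by
  rw [← (repEquiv m).tsum_eq, ENNReal.tsum_prod (f := fun r g =>
    ∫⁻ z in fdInter (toGL (repEquiv m (r, g))), Φ (repEquiv m (r, g)) z), tsum_fintype, Finset.mul_sum]
  refine Finset.sum_congr rfl fun r _ => ?_
  rw [← smul_eq_mul, ← lintegral_smul_measure, ← sum_restrict_fdInter (toGL r.1),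
    lintegral_sum_measure]
  refine tsum_congr fun g => ?_
  rw [repEquiv_apply, toGL_smul]
  simp only [hΦ]

lemma hasSum_integral_fd {E : Type*} [NormedAddCommGroup E] [NormedSpace ℝ E]
    (Φ : DetMatrix m → ℍ → E) (hΦ : ∀ (g : SL(2, ℤ)) A z, Φ (g • A) z = Φ A z) (r : Rep m)
    (hi : IntegrableOn (Φ r.1) ModularGroup.fd) :
    HasSum (fun g : SL(2, ℤ) => ∫ z in fdInter (toGL (g • r.1)), Φ (g • r.1) z)
      ((2 : ℝ) • ∫ z in ModularGroup.fd, Φ r.1 z) := by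
  have h1 : Integrable (Φ r.1)
      (Measure.sum fun γ : SL(2, ℤ) => volume.restrict (fdInter ((γ : GL (Fin 2) ℝ) * toGL r.1))) := by
    rw [sum_restrict_fdInter]
    exact Integrable.smul_measure hi (by norm_num)
  have h2 := hasSum_integral_measure h1
  rw [sum_restrict_fdInter, integral_smul_measure] at h2
  simp only [toGL_smul, hΦ]
  exact h2

lemma hasSum_integral_detMatrix (Φ : DetMatrix m → ℍ → ℂ)
    (hΦ : ∀ (g : SL(2, ℤ)) A z, Φ (g • A) z = Φ A z)
    (hi : ∀ r : Rep m, IntegrableOn (Φ r.1) ModularGroup.fd) :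
    HasSum (fun A : DetMatrix m => ∫ z in fdInter (toGL A), Φ A z)
      (2 * ∑ r : Rep m, ∫ z in ModularGroup.fd, Φ r.1 z) := by
  rw [← (repEquiv m).hasSum_iff]
  -- Absolute summability comes from unfolding `‖Φ‖`; it permits summing over each coset separately.
  have hs : Summable ((fun A : DetMatrix m => ∫ z in fdInter (toGL A), Φ A z) ∘ repEquiv m) := by
    refine Summable.of_norm_bounded
      (g := (fun A : DetMatrix m => ∫ z in fdInter (toGL A), ‖Φ A z‖) ∘ repEquiv m) ?_
      fun p => norm_integral_le_integral_norm _
    rw [summable_prod_of_nonneg (by exact fun p => integral_nonneg fun z => norm_nonneg _)]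
    exact ⟨fun r => (hasSum_integral_fd (fun A z => ‖Φ A z‖) (fun g A z => by rw [hΦ]) r
      (hi r).norm).summable, Summable.of_finite⟩
  have h := hs.hasSum.prod_fiberwise (g := fun r : Rep m => 2 * ∫ z in ModularGroup.fd, Φ r.1 z)
    fun r => by simpa using hasSum_integral_fd Φ hΦ r (hi r)
  have h2 := h.unique (hasSum_fintype _)
  rw [Finset.mul_sum, ← h2]
  exact hs.hasSum

lemma toGL_smul_adj_smul (A : DetMatrix m) (z : ℍ) : toGL (adj A) • toGL A • z = z := by
  rw [← mul_smul, toGL_adj_mul, glScalar_smul]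

lemma preimage_fdInter_adj (A : DetMatrix m) :
    (toGL A • ·) ⁻¹' fdInter (toGL (adj A)) = fdInter (toGL A) := by
  ext z
  simp only [fdInter, Set.mem_preimage, Set.mem_inter_iff, toGL_smul_adj_smul]
  tauto

lemma measurableEmbedding_smul (g : GL (Fin 2) ℝ) : MeasurableEmbedding (g • · : ℍ → ℍ) :=
  (Homeomorph.smul g).measurableEmbedding

/-- The involution `(A, z) ↦ (adj A, A z)` does not change the sum over the left cosets of the
integrals over the fundamental domain. -/
lemma sum_lintegral_fd_adj (Φ : DetMatrix m → ℍ → ENNReal)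
    (hΦ : ∀ (g : SL(2, ℤ)) A z, Φ (g • A) z = Φ A z)
    (hΦ' : ∀ (g : SL(2, ℤ)) A z, Φ (adj (g • A)) (toGL (g • A) • z) = Φ (adj A) (toGL A • z)) :
    ∑ r : Rep m, ∫⁻ z in ModularGroup.fd, Φ r.1 z =
      ∑ r : Rep m, ∫⁻ z in ModularGroup.fd, Φ (adj r.1) (toGL r.1 • z) := by
  have h1 := lintegral_fd_eq_tsum Φ hΦ
  have h2 := lintegral_fd_eq_tsum (fun A z => Φ (adj A) (toGL A • z)) hΦ'
  have h3 : ∑' A : DetMatrix m, ∫⁻ z in fdInter (toGL A), Φ (adj A) (toGL A • z) =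
      ∑' A : DetMatrix m, ∫⁻ z in fdInter (toGL A), Φ A z := by
    rw [← (adjEquiv m).tsum_eq (fun A : DetMatrix m => ∫⁻ z in fdInter (toGL A), Φ A z)]
    refine tsum_congr fun A => ?_
    rw [← preimage_fdInter_adj]
    exact (measurePreserving_smul (toGL A) volume).setLIntegral_comp_preimage_emb
      (measurableEmbedding_smul _) (Φ (adj A)) _
  rw [h3, ← h1] at h2
  exact ((ENNReal.mul_right_inj (by norm_num) (by norm_num)).1 h2).symm

lemma sum_integral_fd_adj (Φ : DetMatrix m → ℍ → ℂ)
    (hΦ : ∀ (g : SL(2, ℤ)) A z, Φ (g • A) z = Φ A z)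
    (hΦ' : ∀ (g : SL(2, ℤ)) A z, Φ (adj (g • A)) (toGL (g • A) • z) = Φ (adj A) (toGL A • z))
    (hi : ∀ r : Rep m, IntegrableOn (Φ r.1) ModularGroup.fd)
    (hi' : ∀ r : Rep m, IntegrableOn (fun z => Φ (adj r.1) (toGL r.1 • z)) ModularGroup.fd) :
    ∑ r : Rep m, ∫ z in ModularGroup.fd, Φ r.1 z =
      ∑ r : Rep m, ∫ z in ModularGroup.fd, Φ (adj r.1) (toGL r.1 • z) := by
  have h1 := hasSum_integral_detMatrix Φ hΦ hi
  have h2 := hasSum_integral_detMatrix (fun A z => Φ (adj A) (toGL A • z)) hΦ' hi'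
  rw [← (adjEquiv m).hasSum_iff] at h1
  have h3 : (fun A : DetMatrix m => ∫ z in fdInter (toGL A), Φ A z) ∘ adjEquiv m =
      fun A => ∫ z in fdInter (toGL A), Φ (adj A) (toGL A • z) := by
    funext A
    rw [← preimage_fdInter_adj]
    exact ((measurePreserving_smul (toGL A) volume).setIntegral_preimage_emb
      (measurableEmbedding_smul _) (Φ (adj A)) _).symm
  rw [h3] at h1
  exact mul_left_cancel₀ two_ne_zero (h1.unique h2)

end

/-! ### Square integrable automorphic functions -/

/-- The continuous functions of weight `k` and multiplier `v` that are square integrable on the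
fundamental domain. -/
def autSpace (v : SL(2, ℤ) → ℂ) (k : ℤ) : Submodule ℂ (ℍ → ℂ) where
  carrier := {f | Continuous f ∧ (∀ (g : SL(2, ℤ)) (z : ℍ), slash k g f z = v g * f z) ∧
    MemLp f 2 (volume.restrict ModularGroup.fd)}
  zero_mem' := ⟨continuous_const, fun g z => by simp [slash], MemLp.zero⟩
  add_mem' := by
    rintro f g ⟨hf1, hf2, hf3⟩ ⟨hg1, hg2, hg3⟩
    refine ⟨hf1.add hg1, fun γ z => ?_, hf3.add hg3⟩
    have h1 := hf2 γ z
    have h2 := hg2 γ z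
    simp only [slash, Pi.add_apply, mul_add] at *
    rw [h1, h2]
  smul_mem' := by
    rintro c f ⟨hf1, hf2, hf3⟩
    refine ⟨hf1.const_smul c, fun γ z => ?_, hf3.const_smul c⟩
    have h1 := hf2 γ z
    simp only [slash, Pi.smul_apply, smul_eq_mul] at *
    linear_combination c * h1

lemma maassSpace_le_autSpace (v : SL(2, ℤ) → ℂ) (k : ℤ) (R : ℝ) :
    maassSpace v k R ≤ autSpace v k := by
  rintro f ⟨h1, h2, -, h4⟩
  refine ⟨?_, h2, h4⟩
  rw [continuous_iff_continuousAt]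
  intro z
  have h := (h1 z).continuousAt.comp (f := ((↑) : ℍ → ℂ)) continuous_coe.continuousAt
  rwa [show (f ∘ ofComplex) ∘ ((↑) : ℍ → ℂ) = f by funext z; simp [ofComplex_apply]] at h

lemma maassSpaceAll_le_autSpace (v : SL(2, ℤ) → ℂ) (k : ℤ) : maassSpaceAll v k ≤ autSpace v k :=
  iSup_le fun R => maassSpace_le_autSpace v k R

/-- Needed to pass from vanishing almost everywhere to vanishing for continuous functions; the
density `1/y²` has no zeros. -/
instance : Measure.IsOpenPosMeasure (volume : Measure ℍ) := by
  have h1 : Measure.IsOpenPosMeasure ((volume : Measure ℂ).comap ((↑) : ℍ → ℂ)) := by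
    refine ⟨fun U hU hne h0 => ?_⟩
    rw [measurableEmbedding_coe.comap_apply] at h0
    exact (isOpenEmbedding_coe.isOpenMap U hU).measure_ne_zero volume (hne.image _) h0
  rw [volume_def]
  refine Measure.AbsolutelyContinuous.isOpenPosMeasure
    (withDensity_absolutelyContinuous' ?_ ?_)
  · refine Measurable.aemeasurable ?_
    have hc : Continuous fun z : ℍ => NNReal.mk z.im z.im_pos.le := continuous_im.subtype_mk _
    exact measurable_coe_nnreal_ennreal.comp
      ((continuous_const.div₀ hc fun x => NNReal.ne_iff.mp x.im_ne_zero).pow 2).measurable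
  · refine Filter.Eventually.of_forall fun z => ?_
    have : NNReal.mk z.im z.im_pos.le ≠ 0 := NNReal.ne_iff.mp z.im_ne_zero
    exact_mod_cast pow_ne_zero 2 (one_div_ne_zero this)

lemma integrableOn_mul_conj {f g : ℍ → ℂ} (hf : MemLp f 2 (volume.restrict ModularGroup.fd))
    (hg : MemLp g 2 (volume.restrict ModularGroup.fd)) :
    IntegrableOn (fun z => f z * conj (g z)) ModularGroup.fd := by
  have h := hg.star
  exact MemLp.integrable_mul hf h

lemma eq_zero_of_petersson_self {v : SL(2, ℤ) → ℂ} {k : ℤ} {f : ℍ → ℂ} (hf : f ∈ autSpace v k)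
    (h0 : petersson f f = 0) : f = 0 := by
  obtain ⟨h1, h2, h3⟩ := hf
  have h4 : ∫ z in ModularGroup.fd, ‖f z‖ ^ 2 = 0 := by
    have h5 (z : ℍ) : f z * conj (f z) = ((‖f z‖ ^ 2 : ℝ) : ℂ) := by
      rw [Complex.mul_conj, Complex.normSq_eq_norm_sq]
    simp only [petersson, h5, integral_complex_ofReal] at h0
    exact_mod_cast h0
  rw [integral_eq_zero_iff_of_nonneg (fun z => by positivity)
    (h3.integrable_norm_pow (by norm_num))] at h4
  have h5 : f =ᵐ[volume.restrict ModularGroup.fd] fun _ => 0 := by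
    filter_upwards [h4] with z hz
    simpa using hz
  -- The domain is the closure of its interior, so vanishing extends to its boundary; automorphy
  -- then carries it to all of `ℍ`.
  have h6 := Measure.eqOn_of_ae_eq h5 h1.continuousOn continuousOn_const (by
    rw [← ModularGroup.fdo_eq_interior_fd, ModularGroup.fd_eq_closure_fdo])
  funext z
  obtain ⟨g, hg⟩ := ModularGroup.exists_smul_mem_fd z
  have h7 := h2 g⁻¹ (g • z)
  rw [slash, inv_smul_smul, h6 hg, mul_zero, mul_eq_zero] at h7
  exact h7.resolve_left (inv_ne_zero (Complex.exp_ne_zero _))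

lemma petersson_sub_right {f g h : ℍ → ℂ} (hf : MemLp f 2 (volume.restrict ModularGroup.fd))
    (hg : MemLp g 2 (volume.restrict ModularGroup.fd))
    (hh : MemLp h 2 (volume.restrict ModularGroup.fd)) :
    petersson f (g - h) = petersson f g - petersson f h := by
  rw [petersson, petersson, petersson, ← integral_sub (integrableOn_mul_conj hf hg)
    (integrableOn_mul_conj hf hh)]
  simp only [Pi.sub_apply, map_sub, mul_sub]

/-- The adjoint identity never uses the eigenvalue equation. Proving it on `autSpace` therefore
covers fixed `R` and the span over all `R` at once. A competing adjoint `B` is excluded by testing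
against `B g - S g`. -/
lemma peterssonAdjointEq_of_autSpace {v v' : SL(2, ℤ) → ℂ} {k : ℤ} {V W : Submodule ℂ (ℍ → ℂ)}
    {T S : (ℍ → ℂ) →ₗ[ℂ] (ℍ → ℂ)} (hV : V ≤ autSpace v k) (hW : W ≤ autSpace v' k)
    (hT : ∀ f ∈ V, T f ∈ W) (hS : ∀ g ∈ W, S g ∈ V)
    (hTS : ∀ f ∈ autSpace v k, ∀ g ∈ autSpace v' k, petersson (T f) g = petersson f (S g)) :
    PeterssonAdjointEq V W T S := by
  refine ⟨hT, hS, fun B => ⟨fun hB => ?_, ?_⟩⟩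
  · ext1 g
    have h1 (f : V) : petersson f (B g : V) = petersson f (S g) := by
      rw [← hB]
      exact hTS _ (hV f.2) _ (hW g.2)
    have h2 : (B g : ℍ → ℂ) - S g ∈ V := V.sub_mem (B g).2 (hS _ g.2)
    have h3 : petersson ((B g : ℍ → ℂ) - S g) ((B g : ℍ → ℂ) - S g) = 0 := by
      rw [petersson_sub_right (hV h2).2.2 (hV (B g).2).2.2 (hV (hS _ g.2)).2.2, sub_eq_zero]
      exact h1 ⟨_, h2⟩
    exact Subtype.ext (sub_eq_zero.1 (eq_zero_of_petersson_self (hV h2) h3))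
  · rintro rfl f g
    exact hTS _ (hV f.2) _ (hW g.2)

lemma conj_eq_inv_of_norm_eq_one {c : ℂ} (hc : ‖c‖ = 1) : conj c = c⁻¹ := by
  rw [Complex.inv_def, Complex.normSq_eq_norm_sq, hc]
  simp

/-! ### Hecke operators on square integrable automorphic functions -/

section

variable {m : ℕ} [NeZero m]

lemma memLp_comp_toGL {v : SL(2, ℤ) → ℂ} {k : ℤ} {f : ℍ → ℂ} (hv : ∀ g, ‖v g‖ = 1)
    (hf : f ∈ autSpace v k) (r : Rep m) :
    MemLp (fun z => f (toGL r.1 • z)) 2 (volume.restrict ModularGroup.fd) := by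
  obtain ⟨h1, h2, h3⟩ := hf
  have hn (g : SL(2, ℤ)) (z : ℍ) : ‖f (g • z)‖ₑ = ‖f z‖ₑ := by
    have h := congrArg (‖·‖) (h2 g z)
    simp only [slash, norm_mul, norm_inv, hv, one_mul,
      show autoFactor k g z = phase k (denom g z) from rfl, norm_phase, inv_one] at h
    rw [← ofReal_norm, ← ofReal_norm, h]
  have hlt := h3.2
  rw [eLpNorm_lt_top_iff_lintegral_rpow_enorm_lt_top (by norm_num) (by norm_num)] at hlt
  refine ⟨(h1.comp (continuous_const_smul _)).aestronglyMeasurable, ?_⟩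
  rw [eLpNorm_lt_top_iff_lintegral_rpow_enorm_lt_top (by norm_num) (by norm_num)]
  -- With this choice the transformed integrand is `|f(adj(A) A z)|² = |f(z)|²`, so the sum over
  -- cosets is a finite multiple of the norm of `f`.
  have h := sum_lintegral_fd_adj (m := m) (fun A z => ‖f (toGL A • z)‖ₑ ^ (2 : ENNReal).toReal)
    (fun g A z => by
      rw [toGL_smul, mul_smul]
      exact congrArg (· ^ _) (hn g _))
    (fun g A z => by rw [toGL_smul_adj_smul, toGL_smul_adj_smul])
  simp only [toGL_smul_adj_smul] at h
  refine lt_of_le_of_lt (Finset.single_le_sum (f := fun r : Rep m =>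
    ∫⁻ z in ModularGroup.fd, ‖f (toGL r.1 • z)‖ₑ ^ (2 : ENNReal).toReal)
    (fun _ _ => zero_le) (Finset.mem_univ r)) ?_
  rw [h]
  exact ENNReal.sum_lt_top.2 fun _ _ => hlt

lemma heckeTerm_rep (k : ℤ) (w : DetMatrix m → ℂ) (f : ℍ → ℂ) (r : Rep m) :
    heckeTerm k w f r.1 = fun z => (w r.1)⁻¹ * f (toGL r.1 • z) := by
  funext z
  rw [heckeTerm, realSlash_rep]

lemma memLp_heckeTerm {v : SL(2, ℤ) → ℂ} {k : ℤ} {f : ℍ → ℂ} (hv : ∀ g, ‖v g‖ = 1)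
    (hf : f ∈ autSpace v k) (w : DetMatrix m → ℂ) (r : Rep m) :
    MemLp (heckeTerm k w f r.1) 2 (volume.restrict ModularGroup.fd) := by
  rw [heckeTerm_rep]
  exact (memLp_comp_toGL hv hf r).const_mul _

lemma heckeSum_mem_autSpace {v v' : SL(2, ℤ) → ℂ} {k : ℤ} {w : DetMatrix m → ℂ}
    (hw : IsHeckeWeight v v' w) (hv : ∀ g, ‖v g‖ = 1) {f : ℍ → ℂ} (hf : f ∈ autSpace v k) :
    heckeSum k w f ∈ autSpace v' k := by
  refine ⟨?_, hw.slash_heckeSum hf.2.1, ?_⟩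
  · refine continuous_const.mul (continuous_finsetSum _ fun r _ => ?_)
    rw [heckeTerm_rep]
    exact continuous_const.mul (hf.1.comp (continuous_const_smul _))
  · exact (memLp_finsetSum _ fun r _ => memLp_heckeTerm hv hf w r).const_mul _

lemma heckeSum_mem_maassSpace {v v' : SL(2, ℤ) → ℂ} {k : ℤ} {R : ℝ} {w : DetMatrix m → ℂ}
    (hw : IsHeckeWeight v v' w) (hv : ∀ g, ‖v g‖ = 1) {f : ℍ → ℂ} (hf : f ∈ maassSpace v k R) :
    heckeSum k w f ∈ maassSpace v' k R := by
  obtain ⟨-, h2, h3⟩ := heckeSum_mem_autSpace hw hv (maassSpace_le_autSpace v k R hf)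
  obtain ⟨h1, h4⟩ := heckeSum_mem_eigenSpace (c := ((1 / 4 + R ^ 2 : ℝ) : ℂ)) (k := k)
    (f := f) ⟨hf.1, hf.3⟩ w
  exact ⟨h1, h2, h4, h3⟩

/-- `adj A * A` is the positive scalar `m`, which acts trivially and has trivial phase. -/
lemma realSlash_adj (k : ℤ) (f : ℍ → ℂ) (A : DetMatrix m) (z : ℍ) :
    realSlash k (toGL (adj A)) f (toGL A • z) = phase k (denom (toGL A) z) * f z := by
  have h := realSlash_mul k (toGL (adj A)) (toGL A) (det_toGL_pos A) f z
  rw [toGL_adj_mul, realSlash, denom_scalar, glScalar_smul, Units.val_mk0,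
    phase_ofReal k (by exact_mod_cast NeZero.pos m), inv_one, one_mul] at h
  rw [h, mul_inv_cancel_left₀ (phase_ne_zero _ _)]

/-- Unit modulus turns inverse weights and phases into conjugates, so the phase from `f|adj A` at
`Az` becomes the slash factor of `g|A` under the conjugation bar. Left invariance of the integrand
uses automorphy of `f` before the substitution and of `g` after it. -/
lemma petersson_heckeSum {v v' v'' : SL(2, ℤ) → ℂ} {k : ℤ} {w w' : DetMatrix m → ℂ}
    (hw : IsHeckeWeight v v' w) (hw' : IsHeckeWeight v' v'' w') (hv : ∀ g, ‖v g‖ = 1)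
    (hv' : ∀ g, ‖v' g‖ = 1) {c : ℂ} (hc : ∀ A, w (adj A) = c * (w' A)⁻¹) {f g : ℍ → ℂ}
    (hf : f ∈ autSpace v k) (hg : g ∈ autSpace v' k) :
    petersson (heckeSum k w f) g = petersson f (c • heckeSum k w' g) := by
  let Φ (A : DetMatrix m) (z : ℍ) : ℂ := heckeTerm k w f A z * conj (g z)
  have hΨ (A : DetMatrix m) (z : ℍ) :
      Φ (adj A) (toGL A • z) = conj c * (f z * conj (heckeTerm k w' g A z)) := by
    have h1 : (w (adj A))⁻¹ = conj c * conj (w' A)⁻¹ := by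
      rw [← conj_eq_inv_of_norm_eq_one (hw.norm_eq _), hc, map_mul]
    have h2 : conj (phase k (denom (toGL A) z))⁻¹ = phase k (denom (toGL A) z) := by
      rw [map_inv₀, conj_eq_inv_of_norm_eq_one (norm_phase _ _), inv_inv]
    simp only [Φ, heckeTerm]
    rw [realSlash_adj, h1, realSlash, map_mul, map_mul, h2]
    ring
  have hi (r : Rep m) : IntegrableOn (Φ r.1) ModularGroup.fd :=
    integrableOn_mul_conj (memLp_heckeTerm hv hf w r) hg.2.2
  have hi' (r : Rep m) :
      IntegrableOn (fun z => f z * conj (heckeTerm k w' g r.1 z)) ModularGroup.fd :=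
    integrableOn_mul_conj hf.2.2 (memLp_heckeTerm hv' hg w' r)
  have key := sum_integral_fd_adj Φ
    (fun γ A z => by simp only [Φ]; rw [hw.heckeTerm_smul hf.2.1])
    (fun γ A z => by rw [hΨ, hΨ, hw'.heckeTerm_smul hg.2.1]) hi
    (fun r => by simp only [hΨ]; exact (hi' r).const_mul _)
  simp only [hΨ, integral_const_mul] at key
  have h1 (z : ℍ) : heckeSum k w f z * conj (g z) =
      (1 / (Real.sqrt m : ℂ)) * ∑ r : Rep m, Φ r.1 z := by
    rw [heckeSum, mul_assoc, Finset.sum_mul]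
  have h2 (z : ℍ) : f z * conj ((c • heckeSum k w' g) z) =
      (1 / (Real.sqrt m : ℂ)) *
        (conj c * ∑ r : Rep m, f z * conj (heckeTerm k w' g r.1 z)) := by
    rw [Pi.smul_apply, smul_eq_mul, heckeSum, map_mul, map_mul, map_sum, ← Finset.mul_sum,
      map_div₀, map_one, Complex.conj_ofReal]
    ring
  simp only [petersson, h1, h2, integral_const_mul]
  rw [integral_finsetSum _ fun r _ => hi r, integral_finsetSum _ fun r _ => hi' r, key,
    ← Finset.mul_sum]

lemma peterssonAdjointEq_of_weights {v v' : SL(2, ℤ) → ℂ} {k : ℤ} {w w' : DetMatrix m → ℂ}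
    (hw : IsHeckeWeight v v' w) (hw' : IsHeckeWeight v' v w') (hv : ∀ g, ‖v g‖ = 1)
    (hv' : ∀ g, ‖v' g‖ = 1) {c : ℂ} (hc : ∀ A, w (adj A) = c * (w' A)⁻¹)
    {T S : (ℍ → ℂ) →ₗ[ℂ] (ℍ → ℂ)} (hT : ∀ f, T f = heckeSum k w f)
    (hS : ∀ f, S f = c • heckeSum k w' f) :
    (∀ R : ℝ, PeterssonAdjointEq (maassSpace v k R) (maassSpace v' k R) T S) ∧
      PeterssonAdjointEq (maassSpaceAll v k) (maassSpaceAll v' k) T S := by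
  have hTR (R : ℝ) : ∀ f ∈ maassSpace v k R, T f ∈ maassSpace v' k R := fun f hf => by
    rw [hT]
    exact heckeSum_mem_maassSpace hw hv hf
  have hSR (R : ℝ) : ∀ f ∈ maassSpace v' k R, S f ∈ maassSpace v k R := fun f hf => by
    rw [hS]
    exact Submodule.smul_mem _ _ (heckeSum_mem_maassSpace hw' hv' hf)
  have hTS : ∀ f ∈ autSpace v k, ∀ g ∈ autSpace v' k, petersson (T f) g = petersson f (S g) := by
    intro f hf g hg
    rw [hT, hS]
    exact petersson_heckeSum hw hw' hv hv' hc hf hg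
  have hall {u u' : SL(2, ℤ) → ℂ} {L : (ℍ → ℂ) →ₗ[ℂ] (ℍ → ℂ)}
      (hL : ∀ R : ℝ, ∀ f ∈ maassSpace u k R, L f ∈ maassSpace u' k R) :
      ∀ f ∈ maassSpaceAll u k, L f ∈ maassSpaceAll u' k := by
    have h : maassSpaceAll u k ≤ (maassSpaceAll u' k).comap L :=
      iSup_le fun R f hf => Submodule.mem_iSup_of_mem R (hL R f hf)
    exact h
  exact ⟨fun R => peterssonAdjointEq_of_autSpace (maassSpace_le_autSpace v k R)
    (maassSpace_le_autSpace v' k R) (hTR R) (hSR R) hTS,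
    peterssonAdjointEq_of_autSpace (maassSpaceAll_le_autSpace v k)
      (maassSpaceAll_le_autSpace v' k) (hall hTR) (hall hSR) hTS⟩

end

end EtaMaass

end

theorem mainTheorem6 (k : ℤ) (hk : ¬ (12 : ℤ) ∣ k) :
    (∀ n : ℕ, 0 < n → k * n ≡ k [ZMOD 12] →
      (∀ R : ℝ, EtaMaass.PeterssonAdjointEq
        (EtaMaass.maassSpace (EtaMaass.multiplier k) k R)
        (EtaMaass.maassSpace (EtaMaass.multiplier k) k R)
        (EtaMaass.hecke (EtaMaass.multiplier k) k n)
        (EtaMaass.hecke (EtaMaass.multiplier k) k n)) ∧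
      EtaMaass.PeterssonAdjointEq
        (EtaMaass.maassSpaceAll (EtaMaass.multiplier k) k)
        (EtaMaass.maassSpaceAll (EtaMaass.multiplier k) k)
        (EtaMaass.hecke (EtaMaass.multiplier k) k n)
        (EtaMaass.hecke (EtaMaass.multiplier k) k n)) ∧
    (∀ m : ℕ, 0 < m → k * m ≡ -k [ZMOD 12] →
      (∀ R : ℝ,
        EtaMaass.PeterssonAdjointEq
          (EtaMaass.maassSpace (EtaMaass.multiplier k) k R)
          (EtaMaass.maassSpace (EtaMaass.conjMultiplier (EtaMaass.multiplier k)) k R)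
          (EtaMaass.hecke (EtaMaass.multiplier k) k m)
          ((-1 : ℂ) ^ k • EtaMaass.hecke (EtaMaass.conjMultiplier (EtaMaass.multiplier k)) k m) ∧
        EtaMaass.PeterssonAdjointEq
          (EtaMaass.maassSpace (EtaMaass.conjMultiplier (EtaMaass.multiplier k)) k R)
          (EtaMaass.maassSpace (EtaMaass.multiplier k) k R)
          (EtaMaass.hecke (EtaMaass.conjMultiplier (EtaMaass.multiplier k)) k m)
          ((-1 : ℂ) ^ k • EtaMaass.hecke (EtaMaass.multiplier k) k m)) ∧
      EtaMaass.PeterssonAdjointEq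
        (EtaMaass.maassSpaceAll (EtaMaass.multiplier k) k)
        (EtaMaass.maassSpaceAll (EtaMaass.conjMultiplier (EtaMaass.multiplier k)) k)
        (EtaMaass.hecke (EtaMaass.multiplier k) k m)
        ((-1 : ℂ) ^ k • EtaMaass.hecke (EtaMaass.conjMultiplier (EtaMaass.multiplier k)) k m) ∧
      EtaMaass.PeterssonAdjointEq
        (EtaMaass.maassSpaceAll (EtaMaass.conjMultiplier (EtaMaass.multiplier k)) k)
        (EtaMaass.maassSpaceAll (EtaMaass.multiplier k) k)
        (EtaMaass.hecke (EtaMaass.conjMultiplier (EtaMaass.multiplier k)) k m)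
        ((-1 : ℂ) ^ k • EtaMaass.hecke (EtaMaass.multiplier k) k m)) := by
  refine ⟨fun n hn h => ?_, fun m hm h => ?_⟩
  · have : NeZero n := ⟨hn.ne'⟩
    have hw := EtaMaass.isHeckeWeight_weightPos h
    have hv := EtaMaass.norm_multiplier k
    exact EtaMaass.peterssonAdjointEq_of_weights hw hw hv hv (c := 1)
      (fun A => by rw [one_mul, EtaMaass.weightPos_adj h])
      (EtaMaass.hecke_multiplier_pos k)
      (fun f => by rw [one_smul, EtaMaass.hecke_multiplier_pos k f])
  · have : NeZero m := ⟨hm.ne'⟩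
    have hw := EtaMaass.isHeckeWeight_weightNeg h
    have hv := EtaMaass.norm_multiplier k
    have hv' := EtaMaass.norm_conjMultiplier k
    have hcc : EtaMaass.conjMultiplier (EtaMaass.conjMultiplier (EtaMaass.multiplier k)) =
        EtaMaass.multiplier k := by
      funext g
      simp [EtaMaass.conjMultiplier]
    have hw' := hw.conj
    rw [hcc] at hw'
    have hconj (A : EtaMaass.DetMatrix m) :
        conj (EtaMaass.weightNeg k A) = (EtaMaass.weightNeg k A)⁻¹ :=
      EtaMaass.conj_eq_inv_of_norm_eq_one (hw.norm_eq A)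
    have h1 := EtaMaass.peterssonAdjointEq_of_weights hw hw' hv hv' (c := (-1) ^ k)
      (T := EtaMaass.hecke (EtaMaass.multiplier k) k m)
      (S := (-1 : ℂ) ^ k • EtaMaass.hecke (EtaMaass.conjMultiplier (EtaMaass.multiplier k)) k m)
      -- The partner weight is `conj w = w⁻¹`, so `w(adj A) = (-1)^k w(A)` has the required form
      -- with `c = (-1)^k`.
      (fun A => by rw [EtaMaass.weightNeg_adj h, hconj, inv_inv])
      (EtaMaass.hecke_multiplier_neg h)
      (fun f => by rw [LinearMap.smul_apply, EtaMaass.hecke_conjMultiplier h f])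
    have h2 := EtaMaass.peterssonAdjointEq_of_weights hw' hw hv' hv (c := (-1) ^ k)
      (T := EtaMaass.hecke (EtaMaass.conjMultiplier (EtaMaass.multiplier k)) k m)
      (S := (-1 : ℂ) ^ k • EtaMaass.hecke (EtaMaass.multiplier k) k m)
      (fun A => by rw [EtaMaass.weightNeg_adj h, map_mul, hconj, map_zpow₀, map_neg, map_one])
      (EtaMaass.hecke_conjMultiplier h)
      (fun f => by rw [LinearMap.smul_apply, EtaMaass.hecke_multiplier_neg h f])
    exact ⟨fun R => ⟨h1.1 R, h2.1 R⟩, h1.2, h2.2⟩
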